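/- Let $a>b>0$ and $\varepsilon_0>0$, and put $r^2=a^2-b^2$. Let $$\mathcal P^6=\{(\mathbf M,\boldsymbol\alpha,\boldsymbol\beta)\in\mathbb R^3\times\mathbb R^3\times\mathbb R^3:\ \boldsymbol\alpha\cdot\boldsymbol\alpha=a^2,\ \boldsymbol\beta\cdot\boldsymbol\beta=b^2,\ \boldsymbol\alpha\cdot\boldsymbol\beta=0\}$$ be the phase space of the generalized two-field gyrostat with zero gyrostatic momentum. On $\mathcal P^6$ put $$x_{1,2}=(\alpha_1-\beta_2)\pm i(\alpha_2+\beta_1),\quad z_{1,2}=\alpha_3\pm i\beta_3,\quad w_{1,2}=\tfrac12(M_1\pm iM_2),\quad w_3=M_3,$$ and, for $\varepsilon_1\in\mathbb R$, $$\xi_1=w_1^2+\varepsilon_0x_1-i\varepsilon_1(x_1w_3-2z_1w_1)-\varepsilon_1^2r^2,\qquad \xi_2=w_2^2+\varepsilon_0x_2+i\varepsilon_1(x_2w_3-2z_2w_2)-\varepsilon_1^2r^2.$$ Where $x_1x_2\neq0$, let $$F=\sqrt{x_1x_2}\,w_3-\frac{x_2z_1w_1+x_1z_2w_2}{\sqrt{x_1x_2}}+i\varepsilon_1r^2\,\frac{x_1-x_2}{\sqrt{x_1x_2}},\qquad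 F_1=\frac{x_2}{x_1}\xi_1-\frac{x_1}{x_2}\xi_2,$$ and let $\mathfrak M_2$ be the closure of the set $\{x_1x_2\ne0,\ F=0,\ F_1=0\}\subset\mathcal P^6$. Then there is $\delta>0$, depending only on $a,b,\varepsilon_0$, such that for every real $\varepsilon_1$ with $|\varepsilon_1|<\delta$ the set $\mathfrak M_2$ is a (nonempty) smooth 4-dimensional manifold, namely an embedded $C^\infty$ submanifold of $\mathbb R^9$ contained in $\mathcal P^6$. -/

import Mathlib

open scoped ContDiff

namespace GTFG

/-- A subset `S` of a normed space is a smooth `k`-dimensional (embedded) submanifold if every point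
of `S` has a neighbourhood `S ∩ U` in `S` which is diffeomorphic to an open subset `V` of `ℝᵏ`:
`φ` is a smooth parametrization of `S ∩ U` by `V`, and its inverse is the restriction to `S ∩ U` of
a smooth map `ψ` defined on the open set `U`. -/
def IsSmoothSubmanifold {E : Type*} [NormedAddCommGroup E] [NormedSpace ℝ E]
    (k : ℕ) (S : Set E) : Prop :=
  ∀ q ∈ S, ∃ (U : Set E) (V : Set (Fin k → ℝ)) (φ : (Fin k → ℝ) → E) (ψ : E → (Fin k → ℝ)),
    IsOpen U ∧ q ∈ U ∧ IsOpen V ∧ ContDiffOn ℝ ∞ φ V ∧ ContDiffOn ℝ ∞ ψ U ∧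
      φ '' V = S ∩ U ∧ ∀ v ∈ V, ψ (φ v) = v

/-- The space `ℝ⁹` of triples `(M, α, β)` of vectors in `ℝ³`. -/
abbrev V9 : Type := (Fin 3 → ℝ) × (Fin 3 → ℝ) × (Fin 3 → ℝ)

/-- The kinetic momentum `M`. -/
def mom (q : V9) : Fin 3 → ℝ := q.1

/-- The first field `α`. -/
def al (q : V9) : Fin 3 → ℝ := q.2.1

/-- The second field `β`. -/
def be (q : V9) : Fin 3 → ℝ := q.2.2

/-- The phase space: orthogonal fields `α`, `β` of intensities `a`, `b`. -/
def P6 (a b : ℝ) : Set V9 :=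
  {q | al q ⬝ᵥ al q = a ^ 2 ∧ be q ⬝ᵥ be q = b ^ 2 ∧ al q ⬝ᵥ be q = 0}

noncomputable section

/-! The complex variables, with vector components indexed from `0`. -/

def x₁ (q : V9) : ℂ := (al q 0 - be q 1) + Complex.I * (al q 1 + be q 0)

def x₂ (q : V9) : ℂ := (al q 0 - be q 1) - Complex.I * (al q 1 + be q 0)

def z₁ (q : V9) : ℂ := al q 2 + Complex.I * be q 2

def z₂ (q : V9) : ℂ := al q 2 - Complex.I * be q 2

def w₁ (q : V9) : ℂ := (mom q 0 + Complex.I * mom q 1) / 2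

def w₂ (q : V9) : ℂ := (mom q 0 - Complex.I * mom q 1) / 2

/-- `w₃ = M₃ - λ` with zero gyrostatic momentum `λ = 0`. -/
def w₃ (q : V9) : ℂ := mom q 2

/-- `√(x₁ x₂)`; the number `x₁ x₂` is real and nonnegative. -/
def sqrtX (q : V9) : ℂ := (Real.sqrt (x₁ q * x₂ q).re : ℝ)

/-- `r² = a² - b²`. -/
def rSq (a b : ℝ) : ℂ := ((a ^ 2 - b ^ 2 : ℝ) : ℂ)

def ξ₁ (a b ε₀ ε₁ : ℝ) (q : V9) : ℂ :=
  w₁ q ^ 2 + ε₀ * x₁ q - Complex.I * ε₁ * (x₁ q * w₃ q - 2 * z₁ q * w₁ q) - ε₁ ^ 2 * rSq a b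

def ξ₂ (a b ε₀ ε₁ : ℝ) (q : V9) : ℂ :=
  w₂ q ^ 2 + ε₀ * x₂ q + Complex.I * ε₁ * (x₂ q * w₃ q - 2 * z₂ q * w₂ q) - ε₁ ^ 2 * rSq a b

def F (a b ε₁ : ℝ) (q : V9) : ℂ :=
  sqrtX q * w₃ q - (x₂ q * z₁ q * w₁ q + x₁ q * z₂ q * w₂ q) / sqrtX q
    + Complex.I * ε₁ * rSq a b * ((x₁ q - x₂ q) / sqrtX q)

def F₁ (a b ε₀ ε₁ : ℝ) (q : V9) : ℂ :=
  x₂ q / x₁ q * ξ₁ a b ε₀ ε₁ q - x₁ q / x₂ q * ξ₂ a b ε₀ ε₁ q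

/-- The critical set: the closure of `{F = 0, F₁ = 0}`, where `F`, `F₁` are functions on the part
`x₁ x₂ ≠ 0` of the phase space. (The phase space is closed in `ℝ⁹`.) -/
def M2 (a b ε₀ ε₁ : ℝ) : Set V9 :=
  closure {q | q ∈ P6 a b ∧ x₁ q * x₂ q ≠ 0 ∧ F a b ε₁ q = 0 ∧ F₁ a b ε₀ ε₁ q = 0}

end

end GTFG

/-!
Introduce polar coordinates `x₁ = ρ exp (iθ)` with `ρ` of either sign, that is, blow up `ℝ⁹` along
`x₁ = 0`, and rotate the remaining complex variables by `θ`. The equations of the phase space and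
`F = 0` become quadratic, and `F₁ = 0` becomes `2UV = ρ σ`, where `σ` is `slope`. Modulo the other
equations, `u²` times the latter is divisible by `ρ`, and the quotient is an equation for the strict
transform near `ρ = 0`, where `u ≠ 0`. On either chart the five equations are independent, so the
strict transform is a smooth 4-manifold in which the points with `ρ ≠ 0` are dense, and `M2` is its
image. On it, the blow-down identifies only `(θ, ρ)` with `(θ + π, -ρ)`: over `x₁ = 0`, where all
`θ` have the same `x₁`, the angle is still determined modulo `π` by `V` if `V ≠ 0`, and otherwise by
`σ = 0`, an equation `Im (exp (iθ) c) = 0` with `c ≠ 0`. That `c ≠ 0` is where `2 a ε₁² < ε₀`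
enters, because `|y₁| < 2 a` on the phase space. The infinitesimal version of the same argument
shows that the blow-down is an immersion on the strict transform, and restricted to a strip of width
`π` in `θ` it is proper, so it carries local charts to charts of `M2`.
-/

namespace GTFG

open Filter Module Topology

section Submersion

theorem map_eq_top_of_forall_dotProduct {𝕜 X ι : Type*} [Field 𝕜] [AddCommGroup X] [Module 𝕜 X]
    [Fintype ι] {L : X →ₗ[𝕜] ι → 𝕜} {K : Submodule 𝕜 X}
    (h : ∀ c : ι → 𝕜, (∀ v ∈ K, c ⬝ᵥ L v = 0) → c = 0) : K.map L = ⊤ := by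
  classical
  by_contra hK
  obtain ⟨f, hf, hKf⟩ := Submodule.exists_le_ker_of_lt_top _ (lt_top_iff_ne_top.2 hK)
  have hf_apply : ∀ y, f y = (fun i => f (Pi.single i 1)) ⬝ᵥ y := fun y => by
    rw [LinearMap.pi_apply_eq_sum_univ f y]
    simp only [dotProduct, smul_eq_mul, mul_comm, ← Pi.single_apply, Pi.single_comm]
  have hc := h (fun i => f (Pi.single i 1)) fun v hv =>
    (hf_apply _).symm.trans (hKf (Submodule.mem_map_of_mem hv))
  exact hf (LinearMap.ext fun y => by rw [hf_apply, hc, zero_dotProduct, LinearMap.zero_apply])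

theorem exists_complementary_functional {𝕜 X Y E : Type*} [NontriviallyNormedField 𝕜]
    [CompleteSpace 𝕜]
    [NormedAddCommGroup X] [NormedSpace 𝕜 X] [FiniteDimensional 𝕜 X]
    [NormedAddCommGroup Y] [NormedSpace 𝕜 Y] [FiniteDimensional 𝕜 Y]
    [NormedAddCommGroup E] [NormedSpace 𝕜 E] [FiniteDimensional 𝕜 E] {k : ℕ}
    {A : X →L[𝕜] Y} {B : X →L[𝕜] E} (hA : Function.Surjective A)
    (hinj : ∀ v, A v = 0 → B v = 0 → v = 0) (hdim : finrank 𝕜 X = finrank 𝕜 Y + k) :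
    ∃ (C : E →L[𝕜] (Fin k → 𝕜)) (e : X ≃L[𝕜] Y × (Fin k → 𝕜)),
      (e : X →L[𝕜] Y × (Fin k → 𝕜)) = A.prod (C.comp B) := by
  let T := LinearMap.ker (A : X →ₗ[𝕜] Y)
  have hTk : finrank 𝕜 T = finrank 𝕜 (Fin k → 𝕜) := by
    have hrank := LinearMap.finrank_range_add_finrank_ker (A : X →ₗ[𝕜] Y)
    rw [LinearMap.range_eq_top.2 hA, finrank_top, hdim] at hrank
    rw [finrank_fin_fun]
    exact Nat.add_left_cancel hrank
  have hker : LinearMap.ker ((B : X →ₗ[𝕜] E).comp T.subtype) = ⊥ :=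
    LinearMap.ker_eq_bot'.2 fun v hv => Subtype.ext (hinj v v.2 hv)
  obtain ⟨g, hg⟩ := LinearMap.exists_leftInverse_of_injective _ hker
  let i : T ≃ₗ[𝕜] (Fin k → 𝕜) := LinearEquiv.ofFinrankEq _ _ hTk
  let C : E →L[𝕜] (Fin k → 𝕜) := LinearMap.toContinuousLinearMap (i.toLinearMap.comp g)
  have hinj' : Function.Injective (A.prod (C.comp B)).toLinearMap := by
    rw [← LinearMap.ker_eq_bot, LinearMap.ker_eq_bot']
    intro v hv
    have hAv : A v = 0 := congrArg Prod.fst hv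
    have hgv : g (B v) = (⟨v, hAv⟩ : T) := LinearMap.congr_fun hg ⟨v, hAv⟩
    have hv0 : (⟨v, hAv⟩ : T) = 0 :=
      (LinearEquiv.map_eq_zero_iff i).1 (hgv ▸ congrArg Prod.snd hv)
    exact congrArg Subtype.val hv0
  have hd : finrank 𝕜 X = finrank 𝕜 (Y × (Fin k → 𝕜)) := by
    rw [finrank_prod, finrank_fin_fun, hdim]
  exact ⟨C, (LinearEquiv.ofInjectiveOfFinrankEq _ hinj' hd).toContinuousLinearEquiv, rfl⟩

theorem exists_openPartialHomeomorph_contDiffOn_symm {𝕜 E F : Type*} [RCLike 𝕜]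
    [NormedAddCommGroup E] [NormedSpace 𝕜 E] [CompleteSpace E]
    [NormedAddCommGroup F] [NormedSpace 𝕜 F] {f : E → F} {e : E ≃L[𝕜] F} {p : E} {n : ℕ∞ω}
    (hf : ContDiff 𝕜 n f) (he : HasFDerivAt f (e : E →L[𝕜] F) p) (hn : n ≠ 0) {N : Set E}
    (hN : N ∈ 𝓝 p) :
    ∃ T : OpenPartialHomeomorph E F, ⇑T = f ∧ p ∈ T.source ∧ T.source ⊆ N ∧
      ContDiffOn 𝕜 n T.symm T.target := by
  let T := hf.contDiffAt.toOpenPartialHomeomorph f he hn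
  have hp : p ∈ T.source := hf.contDiffAt.mem_toOpenPartialHomeomorph_source he hn
  let R := Set.range ((↑) : (E ≃L[𝕜] F) → (E →L[𝕜] F))
  have hR : IsOpen (fderiv 𝕜 f ⁻¹' R) :=
    ContinuousLinearEquiv.isOpen.preimage (hf.continuous_fderiv hn)
  refine ⟨T.restrOpen (interior N ∩ fderiv 𝕜 f ⁻¹' R) (isOpen_interior.inter hR), rfl,
    ⟨hp, mem_interior_iff_mem_nhds.2 hN, e, he.fderiv.symm⟩,
    fun x hx => interior_subset hx.2.1, fun y hy => ?_⟩
  obtain ⟨i, hi⟩ := (OpenPartialHomeomorph.map_target _ hy).2.2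
  have hTi : HasFDerivAt f (i : E →L[𝕜] F) (T.symm y) :=
    hi ▸ (hf.contDiffAt.differentiableAt hn).hasFDerivAt
  exact (T.contDiffAt_symm hy.1 hTi hf.contDiffAt).contDiffWithinAt

/-- The condition which `IsSmoothSubmanifold k S` imposes at the single point `q`. -/
def HasSmoothChartAt {E : Type*} [NormedAddCommGroup E] [NormedSpace ℝ E]
    (k : ℕ) (S : Set E) (q : E) : Prop :=
  ∃ (U : Set E) (V : Set (Fin k → ℝ)) (φ : (Fin k → ℝ) → E) (ψ : E → (Fin k → ℝ)),
    IsOpen U ∧ q ∈ U ∧ IsOpen V ∧ ContDiffOn ℝ ∞ φ V ∧ ContDiffOn ℝ ∞ ψ U ∧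
      φ '' V = S ∩ U ∧ ∀ v ∈ V, ψ (φ v) = v

theorem HasSmoothChartAt.of_levelSet {X Y E : Type*}
    [NormedAddCommGroup X] [NormedSpace ℝ X] [FiniteDimensional ℝ X]
    [NormedAddCommGroup Y] [NormedSpace ℝ Y] [FiniteDimensional ℝ Y]
    [NormedAddCommGroup E] [NormedSpace ℝ E] [FiniteDimensional ℝ E] {k : ℕ}
    {S : Set E} {G : X → Y} {Ψ : X → E} {p : X} (hG : ContDiff ℝ ∞ G) (hΨ : ContDiff ℝ ∞ Ψ)
    (hsurj : Function.Surjective (fderiv ℝ G p))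
    (hinj : ∀ v, fderiv ℝ G p v = 0 → fderiv ℝ Ψ p v = 0 → v = 0)
    (hdim : finrank ℝ X = finrank ℝ Y + k)
    (hmap : map Ψ (𝓝[G ⁻¹' {0}] p) = 𝓝[S] (Ψ p)) : HasSmoothChartAt k S (Ψ p) := by
  obtain ⟨C, e, he⟩ := exists_complementary_functional hsurj hinj hdim
  have hΦ : HasFDerivAt (fun t => (G t, C (Ψ t))) (e : X →L[ℝ] Y × (Fin k → ℝ)) p := by
    rw [he]
    exact (hG.differentiable (by simp) p).hasFDerivAt.prodMk
      (C.hasFDerivAt.comp p (hΨ.differentiable (by simp) p).hasFDerivAt)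
  obtain ⟨N, hN, hNS⟩ : ∃ N ∈ 𝓝 p, N ∩ G ⁻¹' {0} ⊆ Ψ ⁻¹' S :=
    mem_nhdsWithin_iff_exists_mem_nhds_inter.1 (mem_map.1 (hmap ▸ self_mem_nhdsWithin))
  obtain ⟨T, hT, hpT, hTN, hTsymm⟩ := exists_openPartialHomeomorph_contDiffOn_symm
    (hG.prodMk (C.contDiff.comp hΨ)) hΦ (by simp) hN
  obtain ⟨U, hU, hpU, hUT⟩ : ∃ U, IsOpen U ∧ Ψ p ∈ U ∧ U ∩ S ⊆ Ψ '' (T.source ∩ G ⁻¹' {0}) := by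
    refine mem_nhdsWithin.1 (hmap ▸ image_mem_map ?_)
    exact inter_mem (mem_nhdsWithin_of_mem_nhds (T.open_source.mem_nhds hpT)) self_mem_nhdsWithin
  have hW : IsOpen (T.target ∩ (Ψ ∘ T.symm) ⁻¹' U) :=
    (hΨ.continuous.comp_continuousOn hTsymm.continuousOn).isOpen_inter_preimage T.open_target hU
  have hinv : ∀ v : Fin k → ℝ, ((0 : Y), v) ∈ T.target →
      G (T.symm (0, v)) = 0 ∧ C (Ψ (T.symm (0, v))) = v := fun v hv => by
    have h := T.right_inv hv
    rw [hT] at h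
    exact Prod.ext_iff.1 h
  refine ⟨U, (fun v => ((0 : Y), v)) ⁻¹' (T.target ∩ (Ψ ∘ T.symm) ⁻¹' U),
    fun v => Ψ (T.symm (0, v)), C, hU, hpU, hW.preimage (by fun_prop), ?_, C.contDiff.contDiffOn,
    Set.Subset.antisymm ?_ ?_, fun v hv => (hinv v hv.1).2⟩
  · exact hΨ.comp_contDiffOn (hTsymm.comp (by fun_prop) fun v hv => hv.1)
  · rintro _ ⟨v, ⟨hvT, hvU⟩, rfl⟩
    exact ⟨hNS ⟨hTN (T.map_target hvT), (hinv v hvT).1⟩, hvU⟩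
  · rintro _ ⟨hyS, hyU⟩
    obtain ⟨t, ⟨htT, htG⟩, rfl⟩ := hUT ⟨hyU, hyS⟩
    have hTt : T t = (0, C (Ψ t)) := hT ▸ Prod.ext htG rfl
    have hsymm : T.symm (0, C (Ψ t)) = t := hTt ▸ T.left_inv htT
    have hmem : (0, C (Ψ t)) ∈ T.target := hTt ▸ T.map_source htT
    exact ⟨C (Ψ t), ⟨hmem, by rwa [← hsymm] at hyU⟩, congrArg Ψ hsymm⟩

theorem mem_closure_preimage_of_surjective {X Y : Type*} [NormedAddCommGroup X] [NormedSpace ℝ X]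
    [NormedAddCommGroup Y] [NormedSpace ℝ Y] [CompleteSpace X] [CompleteSpace Y]
    {f : X → Y} {f' : X →L[ℝ] Y} {p : X} {A : Set Y} (hf : HasStrictFDerivAt f f' p)
    (hf' : f'.range = ⊤) (hp : f p ∈ closure A) : p ∈ closure (f ⁻¹' A) := by
  rw [mem_closure_iff_frequently] at hp ⊢
  rwa [← hf.map_nhds_eq_of_surj hf', frequently_map] at hp

end Submersion

theorem map_nhdsWithin_eq_of_isClosedMap {X Y : Type*} [TopologicalSpace X] [TopologicalSpace Y]
    {f : X → Y} {B Z : Set X} {p : X} (hf : Continuous f) (hB : IsClosed B)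
    (hZ : IsClosedMap (Z.domRestrict f)) (hBZ : f '' (B ∩ Z) = f '' B)
    (hp : ∀ t ∈ B ∩ Z, f t = f p → t = p) :
    map f (𝓝[B] p) = 𝓝[f '' B] (f p) := by
  refine le_antisymm (hf.continuousWithinAt.tendsto_nhdsWithin (Set.mapsTo_image f B)) ?_
  intro s hs
  obtain ⟨O, hO, hOs⟩ := mem_nhdsWithin_iff_exists_mem_nhds_inter.1 (mem_map.1 hs)
  have hfib : ∀ᶠ y in 𝓝 (f p), ∀ t : Z, f t = y → (t : X) ∈ B → f t ∈ s := by
    refine hZ.eventually_nhds_fiber (y₀ := f p) (p := fun t : Z => (t : X) ∈ B → f t ∈ s)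
      fun t ht => ?_
    by_cases htB : (t : X) ∈ B
    · have hOt : O ∈ 𝓝 (t : X) := hp t ⟨htB, t.2⟩ ht ▸ hO
      filter_upwards [continuous_subtype_val.continuousAt.preimage_mem_nhds hOt] with u hu huB
      exact hOs ⟨hu, huB⟩
    · filter_upwards [continuous_subtype_val.continuousAt.preimage_mem_nhds
        (hB.isOpen_compl.mem_nhds htB)] with u hu huB
      exact absurd huB hu
  rw [← hBZ]
  filter_upwards [mem_nhdsWithin_of_mem_nhds hfib, self_mem_nhdsWithin]
  rintro _ hy ⟨t, ⟨htB, htZ⟩, rfl⟩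
  exact hy ⟨t, htZ⟩ rfl htB

noncomputable section

open Complex hiding sin cos
open Real (sin cos pi_pos)
open scoped ComplexConjugate Real

section Angle

theorem exp_mul_I_mul_conj (θ : ℝ) : exp (θ * I) * conj (exp (θ * I)) = 1 := by
  rw [mul_conj, normSq_eq_norm_sq, norm_exp_ofReal_mul_I, one_pow, ofReal_one]

theorem exists_im_exp_mul_I_mul_eq_zero (θ : ℝ) (ζ : ℂ) :
    ∃ τ ∈ Set.Icc (θ - π / 2) (θ + π / 2), (exp (τ * I) * ζ).im = 0 := by
  obtain ⟨n, hn, -⟩ := existsUnique_add_zsmul_mem_Ico pi_pos (-arg ζ) (θ - π / 2)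
  refine ⟨-arg ζ + n • π, ⟨hn.1, by linarith [hn.2]⟩, ?_⟩
  have hreal : exp ((-arg ζ + n • π : ℝ) * I) * ζ = ‖ζ‖ * exp ((n * π : ℝ) * I) := by
    nth_rw 2 [← norm_mul_exp_arg_mul_I ζ]
    rw [mul_left_comm, ← Complex.exp_add]
    congr 2
    push_cast [zsmul_eq_mul]
    ring
  rw [hreal, im_ofReal_mul, exp_ofReal_mul_I_im, Real.sin_int_mul_pi, mul_zero]

theorem eq_of_im_exp_mul_I_mul_eq_zero {θ τ : ℝ} {ζ : ℂ} (hζ : ζ ≠ 0)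
    (hτ : τ ∈ Set.Icc (θ - π / 2) (θ + π / 2)) (hθζ : (exp (θ * I) * ζ).im = 0)
    (hτζ : (exp (τ * I) * ζ).im = 0) : τ = θ := by
  have hrot : exp (τ * I) * ζ = exp ((τ - θ : ℝ) * I) * (exp (θ * I) * ζ) := by
    rw [← mul_assoc, ← Complex.exp_add]
    congr 2
    push_cast
    ring
  have hre : (exp (θ * I) * ζ).re ≠ 0 := fun h =>
    mul_ne_zero (Complex.exp_ne_zero _) hζ (Complex.ext h hθζ)
  rw [hrot, mul_im, hθζ, mul_zero, zero_add, exp_ofReal_mul_I_im] at hτζ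
  have hsin := (mul_eq_zero.1 hτζ).resolve_right hre
  exact sub_eq_zero.1 ((Real.sin_eq_zero_iff_of_lt_of_lt (by linarith [hτ.1, pi_pos])
    (by linarith [hτ.2, pi_pos])).1 hsin)

end Angle

section Variables

/-- The complex combination of the fields which completes `x₁` and `z₁` to a system of complex
coordinates on the space of pairs `(α, β)`. -/
def y₁ (q : V9) : ℂ := (al q 0 + be q 1) + I * (be q 0 - al q 1)

/-- The point of `ℝ⁹` at which `x₁`, `y₁`, `z₁`, `w₁` and `M₃` take prescribed values. -/
def ofComplex (x y z w : ℂ) (m : ℝ) : V9 :=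
  (![2 * w.re, 2 * w.im, m], ![(x.re + y.re) / 2, (x.im - y.im) / 2, z.re],
    ![(x.im + y.im) / 2, (y.re - x.re) / 2, z.im])

variable (q : V9) (x y z w : ℂ) (m : ℝ)

@[simp]
theorem x₁_ofComplex : x₁ (ofComplex x y z w m) = x := by
  apply Complex.ext <;> simp [x₁, ofComplex, al, be] <;> ring

@[simp]
theorem y₁_ofComplex : y₁ (ofComplex x y z w m) = y := by
  apply Complex.ext <;> simp [y₁, ofComplex, al, be] <;> ring

@[simp]
theorem z₁_ofComplex : z₁ (ofComplex x y z w m) = z := by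
  apply Complex.ext <;> simp [z₁, ofComplex, al, be]

@[simp]
theorem w₁_ofComplex : w₁ (ofComplex x y z w m) = w := by
  apply Complex.ext <;> simp [w₁, ofComplex, mom]

@[simp]
theorem mom_two_ofComplex : mom (ofComplex x y z w m) 2 = m := rfl

theorem ofComplex_self : ofComplex (x₁ q) (y₁ q) (z₁ q) (w₁ q) (mom q 2) = q := by
  refine Prod.ext (funext fun i => ?_) (Prod.ext (funext fun i => ?_) (funext fun i => ?_)) <;>
    fin_cases i <;> simp [ofComplex, x₁, y₁, z₁, w₁, mom, al, be] <;> ring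

theorem re_add_mul_I (x y : ℝ) : (x + y * I : ℂ).re = x := by simp

theorem im_add_mul_I (x y : ℝ) : (x + y * I : ℂ).im = y := by simp

theorem x₂_eq_conj : x₂ q = conj (x₁ q) := by simp [x₁, x₂]; ring

theorem z₂_eq_conj : z₂ q = conj (z₁ q) := by simp [z₁, z₂]; ring

theorem w₂_eq_conj : w₂ q = conj (w₁ q) := by simp [w₁, w₂, map_ofNat]; ring

theorem ξ₂_eq_conj (a b ε₀ ε₁ : ℝ) : ξ₂ a b ε₀ ε₁ q = conj (ξ₁ a b ε₀ ε₁ q) := by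
  simp [ξ₁, ξ₂, x₂_eq_conj, z₂_eq_conj, w₂_eq_conj, w₃, rSq, map_ofNat]

theorem x₁_mul_y₁_add_z₁_sq : x₁ q * y₁ q + z₁ q ^ 2 =
    (al q ⬝ᵥ al q - be q ⬝ᵥ be q : ℝ) + (2 * al q ⬝ᵥ be q : ℝ) * I := by
  simp only [x₁, y₁, z₁, dotProduct, Fin.sum_univ_three]
  push_cast
  linear_combination ((al q 1 : ℂ) + be q 0) * (be q 0 - al q 1) * I_sq + (be q 2 : ℂ) ^ 2 * I_sq

theorem normSq_x₁_add_normSq_y₁_add_normSq_z₁ :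
    normSq (x₁ q) + normSq (y₁ q) + 2 * normSq (z₁ q) =
      2 * (al q ⬝ᵥ al q + be q ⬝ᵥ be q) := by
  have hx : x₁ q = (al q 0 - be q 1 : ℝ) + (al q 1 + be q 0 : ℝ) * I := by
    push_cast [x₁, mul_comm I]; rfl
  have hy : y₁ q = (al q 0 + be q 1 : ℝ) + (be q 0 - al q 1 : ℝ) * I := by
    push_cast [y₁, mul_comm I]; rfl
  rw [hx, hy, z₁, mul_comm I, normSq_add_mul_I, normSq_add_mul_I, normSq_add_mul_I]
  simp only [dotProduct, Fin.sum_univ_three]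
  ring

theorem mem_P6_iff {a b : ℝ} {q : V9} :
    q ∈ P6 a b ↔ x₁ q * y₁ q + z₁ q ^ 2 = rSq a b ∧
      normSq (x₁ q) + normSq (y₁ q) + 2 * normSq (z₁ q) = 2 * (a ^ 2 + b ^ 2) := by
  rw [x₁_mul_y₁_add_z₁_sq, normSq_x₁_add_normSq_y₁_add_normSq_z₁, rSq, Complex.ext_iff,
    re_add_mul_I, im_add_mul_I, ofReal_re, ofReal_im]
  constructor
  · rintro ⟨hα, hβ, hαβ⟩
    rw [hα, hβ, hαβ, mul_zero]
    exact ⟨⟨rfl, rfl⟩, rfl⟩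
  · rintro ⟨⟨hre, him⟩, hnorm⟩
    exact ⟨by linear_combination hre / 2 + hnorm / 4, by linear_combination hnorm / 4 - hre / 2,
      by linear_combination him / 2⟩

end Variables

section CriticalLocus

variable {a b ε₀ ε₁ : ℝ} {q : V9}

/-- The set of regular points of the critical set, whose closure is `M2`. -/
def criticalLocus (a b ε₀ ε₁ : ℝ) : Set V9 :=
  {q | q ∈ P6 a b ∧ x₁ q * x₂ q ≠ 0 ∧ F a b ε₁ q = 0 ∧ F₁ a b ε₀ ε₁ q = 0}

theorem x₁_mul_x₂ (q : V9) : x₁ q * x₂ q = normSq (x₁ q) := by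
  rw [x₂_eq_conj, mul_conj]

theorem sq_sqrtX (q : V9) : sqrtX q ^ 2 = normSq (x₁ q) := by
  rw [sqrtX, x₁_mul_x₂, ofReal_re, ← ofReal_pow, Real.sq_sqrt (normSq_nonneg _)]

theorem sqrtX_ne_zero (hx : x₁ q ≠ 0) : sqrtX q ≠ 0 := by
  rwa [← pow_ne_zero_iff two_ne_zero, sq_sqrtX, ofReal_ne_zero, map_ne_zero]

theorem F_eq_zero_iff (hx : x₁ q ≠ 0) : F a b ε₁ q = 0 ↔
    normSq (x₁ q) * mom q 2 =
      2 * (conj (x₁ q) * z₁ q * w₁ q).re + 2 * ε₁ * (a ^ 2 - b ^ 2) * (x₁ q).im := by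
  have hne := sqrtX_ne_zero hx
  have hre : x₂ q * z₁ q * w₁ q + x₁ q * z₂ q * w₂ q =
      (2 * (conj (x₁ q) * z₁ q * w₁ q).re : ℝ) := by
    rw [← add_conj, x₂_eq_conj, z₂_eq_conj, w₂_eq_conj]
    simp only [map_mul, conj_conj]
  have him : x₁ q - x₂ q = (2 * (x₁ q).im : ℝ) * I := by rw [x₂_eq_conj, sub_conj]
  have hF : sqrtX q * F a b ε₁ q = (normSq (x₁ q) * mom q 2
      - (2 * (conj (x₁ q) * z₁ q * w₁ q).re + 2 * ε₁ * (a ^ 2 - b ^ 2) * (x₁ q).im) : ℝ) := by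
    rw [F, hre, him, w₃]
    field_simp
    push_cast [rSq, sq_sqrtX]
    linear_combination 2 * ε₁ * (a ^ 2 - b ^ 2) * (x₁ q).im * I_sq
  rw [← mul_eq_zero_iff_left hne, hF, ofReal_eq_zero, sub_eq_zero]

theorem F₁_eq_zero_iff (hx : x₁ q ≠ 0) :
    F₁ a b ε₀ ε₁ q = 0 ↔ (conj (x₁ q) ^ 2 * ξ₁ a b ε₀ ε₁ q).im = 0 := by
  have hx₂ : conj (x₁ q) ≠ 0 := (map_ne_zero _).2 hx
  have hF₁ : x₁ q * conj (x₁ q) * F₁ a b ε₀ ε₁ q =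
      (2 * (conj (x₁ q) ^ 2 * ξ₁ a b ε₀ ε₁ q).im : ℝ) * I := by
    rw [← sub_conj, F₁, ξ₂_eq_conj, x₂_eq_conj]
    simp only [map_mul, map_pow, conj_conj]
    field_simp
  rw [← mul_eq_zero_iff_left (mul_ne_zero hx hx₂), hF₁, mul_eq_zero_iff_right I_ne_zero,
    ofReal_eq_zero, mul_eq_zero_iff_left two_ne_zero]

theorem mem_criticalLocus_iff : q ∈ criticalLocus a b ε₀ ε₁ ↔ q ∈ P6 a b ∧ x₁ q ≠ 0 ∧
    normSq (x₁ q) * mom q 2 =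
      2 * (conj (x₁ q) * z₁ q * w₁ q).re + 2 * ε₁ * (a ^ 2 - b ^ 2) * (x₁ q).im ∧
    (conj (x₁ q) ^ 2 * ξ₁ a b ε₀ ε₁ q).im = 0 := by
  have hx : x₁ q * x₂ q ≠ 0 ↔ x₁ q ≠ 0 := by rw [x₁_mul_x₂, ofReal_ne_zero, map_ne_zero]
  rw [criticalLocus, Set.mem_ofPred_eq, hx]
  exact and_congr_right' (and_congr_right fun h => by rw [F_eq_zero_iff h, F₁_eq_zero_iff h])

theorem ξ₁_eq (hq : q ∈ P6 a b) : ξ₁ a b ε₀ ε₁ q =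
    (w₁ q + I * ε₁ * z₁ q) ^ 2 + x₁ q * (ε₀ - I * ε₁ * mom q 2 - ε₁ ^ 2 * y₁ q) := by
  rw [ξ₁, w₃]
  linear_combination (ε₁ : ℂ) ^ 2 * (mem_P6_iff.1 hq).1 - (ε₁ : ℂ) ^ 2 * z₁ q ^ 2 * I_sq

end CriticalLocus

/-- Names of the coordinates on the blow-up of `ℝ⁹` along `x₁ = 0`: with `e = exp (iθ)` they are
given by `x₁ = ρ e`, `e y₁ = g + ih`, `z₁ = u + iv`, `w₁ + iε₁z₁ = e (U + iV)` and
`k = M₃ / 2 + ε₁ Im y₁`. -/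
inductive Coord
  | θ | ρ | u | v | g | h | U | V | k
  deriving DecidableEq

instance : Fintype Coord :=
  ⟨{.θ, .ρ, .u, .v, .g, .h, .U, .V, .k}, by rintro ⟨⟩ <;> decide⟩

section BlowDown

variable {ε₁ θ : ℝ} {q : V9}

/-- The value of `y₁` at the point with blow-up coordinates `t`. -/
def yCoord (t : Coord → ℝ) : ℂ := conj (exp (t .θ * I)) * (t .g + t .h * I)

/-- The parametrization of `ℝ⁹` by the blow-up coordinates. -/
def blowDown (ε₁ : ℝ) (t : Coord → ℝ) : V9 :=
  ofComplex (t .ρ * exp (t .θ * I)) (yCoord t) (t .u + t .v * I)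
    (exp (t .θ * I) * (t .U + t .V * I) - I * ε₁ * (t .u + t .v * I))
    (2 * t .k - 2 * ε₁ * (yCoord t).im)

/-- The blow-up coordinates of a point whose `x₁` is a real multiple of `exp (iθ)`. -/
def blowUpCoord (ε₁ θ : ℝ) (q : V9) : Coord → ℝ
  | .θ => θ
  | .ρ => (exp (θ * I) * x₂ q).re
  | .u => (z₁ q).re
  | .v => (z₁ q).im
  | .g => (exp (θ * I) * y₁ q).re
  | .h => (exp (θ * I) * y₁ q).im
  | .U => (exp (θ * I) * (w₂ q - I * ε₁ * z₂ q)).re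
  | .V => -(exp (θ * I) * (w₂ q - I * ε₁ * z₂ q)).im
  | .k => mom q 2 / 2 + ε₁ * (y₁ q).im

theorem exp_mul_yCoord (t : Coord → ℝ) : exp (t .θ * I) * yCoord t = t .g + t .h * I := by
  rw [yCoord, ← mul_assoc, exp_mul_I_mul_conj, one_mul]

theorem exp_mul_x₂_blowDown (ε₁ : ℝ) (t : Coord → ℝ) :
    exp (t .θ * I) * x₂ (blowDown ε₁ t) = t .ρ := by
  rw [x₂_eq_conj, blowDown, x₁_ofComplex, map_mul, mul_left_comm, exp_mul_I_mul_conj, conj_ofReal,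
    mul_one]

theorem exp_mul_w₂_blowDown (ε₁ : ℝ) (t : Coord → ℝ) :
    exp (t .θ * I) * (w₂ (blowDown ε₁ t) - I * ε₁ * z₂ (blowDown ε₁ t)) =
      t .U - t .V * I := by
  rw [w₂_eq_conj, z₂_eq_conj, blowDown, w₁_ofComplex, z₁_ofComplex]
  simp only [map_add, map_sub, map_mul, conj_ofReal, conj_I]
  linear_combination (t .U - t .V * I : ℂ) * exp_mul_I_mul_conj (t .θ)

theorem blowUpCoord_blowDown (ε₁ : ℝ) (t : Coord → ℝ) :
    blowUpCoord ε₁ (t .θ) (blowDown ε₁ t) = t := by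
  funext i
  have hy : y₁ (blowDown ε₁ t) = yCoord t := y₁_ofComplex ..
  have hz : z₁ (blowDown ε₁ t) = t .u + t .v * I := z₁_ofComplex ..
  have hm : mom (blowDown ε₁ t) 2 = 2 * t .k - 2 * ε₁ * (yCoord t).im := rfl
  cases i <;> simp [blowUpCoord, exp_mul_x₂_blowDown, exp_mul_w₂_blowDown, hy, hz, hm,
    exp_mul_yCoord]
  ring

theorem blowDown_blowUpCoord (h : (exp (θ * I) * x₂ q).im = 0) :
    blowDown ε₁ (blowUpCoord ε₁ θ q) = q := by
  have he := exp_mul_I_mul_conj θ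
  have hx : (exp (θ * I) * x₂ q).re * exp (θ * I) = x₁ q := by
    have hreal : ((exp (θ * I) * x₂ q).re : ℂ) = conj (exp (θ * I) * x₂ q) :=
      Complex.ext rfl (by rw [conj_im, h, ofReal_im, neg_zero])
    rw [hreal, x₂_eq_conj, map_mul, conj_conj]
    linear_combination x₁ q * he
  have hy : yCoord (blowUpCoord ε₁ θ q) = y₁ q := by
    simp only [yCoord, blowUpCoord, re_add_im]
    linear_combination y₁ q * he
  have hz : ((z₁ q).re + (z₁ q).im * I : ℂ) = z₁ q := re_add_im _
  have hw : exp (θ * I) * ((exp (θ * I) * (w₂ q - I * ε₁ * z₂ q)).re +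
      (-(exp (θ * I) * (w₂ q - I * ε₁ * z₂ q)).im : ℝ) * I) = w₁ q + I * ε₁ * z₁ q := by
    rw [← conj_re, ← conj_im, re_add_im, w₂_eq_conj, z₂_eq_conj]
    simp only [map_mul, map_sub, conj_conj, conj_ofReal, conj_I]
    linear_combination (w₁ q + I * ε₁ * z₁ q) * he
  have hm : 2 * blowUpCoord ε₁ θ q .k - 2 * ε₁ * (y₁ q).im = mom q 2 := by
    rw [blowUpCoord]; ring
  rw [blowDown, hy, hm]
  simp only [blowUpCoord, hx, hz, hw, add_sub_cancel_right, ofComplex_self]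

theorem contDiff_ofReal_coord (i : Coord) : ContDiff ℝ ∞ fun t : Coord → ℝ => (t i : ℂ) :=
  ofRealCLM.contDiff.comp (contDiff_apply ℝ ℝ i)

theorem contDiff_exp_θ : ContDiff ℝ ∞ fun t : Coord → ℝ => exp (t .θ * I) := by
  have := contDiff_ofReal_coord
  fun_prop

theorem contDiff_ofComplex {X : Type*} [NormedAddCommGroup X] [NormedSpace ℝ X]
    {x y z w : X → ℂ} {m : X → ℝ} {n : ℕ∞ω} (hx : ContDiff ℝ n x) (hy : ContDiff ℝ n y)
    (hz : ContDiff ℝ n z) (hw : ContDiff ℝ n w) (hm : ContDiff ℝ n m) :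
    ContDiff ℝ n fun t => ofComplex (x t) (y t) (z t) (w t) (m t) := by
  have hre {f : X → ℂ} (hf : ContDiff ℝ n f) : ContDiff ℝ n fun t => (f t).re :=
    reCLM.contDiff.comp hf
  have him {f : X → ℂ} (hf : ContDiff ℝ n f) : ContDiff ℝ n fun t => (f t).im :=
    imCLM.contDiff.comp hf
  refine .prodMk (contDiff_pi.2 fun i => ?_)
    (.prodMk (contDiff_pi.2 fun i => ?_) (contDiff_pi.2 fun i => ?_)) <;>
  · fin_cases i <;> dsimp <;> fun_prop

theorem contDiff_yCoord : ContDiff ℝ ∞ yCoord := by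
  have := contDiff_ofReal_coord
  exact (conjCLE.contDiff.comp contDiff_exp_θ).mul (by fun_prop)

theorem contDiff_blowDown (ε₁ : ℝ) : ContDiff ℝ ∞ (blowDown ε₁) := by
  have := contDiff_ofReal_coord
  have := contDiff_exp_θ
  have hy : ContDiff ℝ ∞ fun t => (yCoord t).im := imCLM.contDiff.comp contDiff_yCoord
  exact contDiff_ofComplex (by fun_prop) contDiff_yCoord (by fun_prop) (by fun_prop) (by fun_prop)

theorem continuous_blowUpCoord (ε₁ : ℝ) :
    Continuous fun p : ℝ × V9 => blowUpCoord ε₁ p.1 p.2 := by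
  refine continuous_pi fun i => ?_
  cases i <;> simp only [blowUpCoord, x₂, y₁, z₁, z₂, w₂, al, be, mom] <;> fun_prop

end BlowDown

section System

variable {a b ε₀ ε₁ : ℝ} {t : Coord → ℝ} {f : (Coord → ℝ) → ℝ}

/-- The imaginary part of `exp (iθ) (ε₀ + 2iε₁k - ε₁²y₁)`; on the phase space, `ρ` times it is,
up to sign, the contribution of the terms of `ξ₁` divisible by `x₁` to `F₁`. -/
def slope (ε₀ ε₁ : ℝ) (t : Coord → ℝ) : ℝ :=
  ε₀ * sin (t .θ) + 2 * ε₁ * t .k * cos (t .θ) - ε₁ ^ 2 * t .h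

/-- The equation `F₁ = 0` in the blow-up coordinates (total transform). -/
def totalF₁ (ε₀ ε₁ : ℝ) (t : Coord → ℝ) : ℝ :=
  2 * t .U * t .V - t .ρ * slope ε₀ ε₁ t

/-- The equation obtained from `F₁ = 0` by eliminating `U` by means of `F = 0` and dividing by `ρ`
(strict transform). -/
def strictF₁ (ε₀ ε₁ : ℝ) (t : Coord → ℝ) : ℝ :=
  2 * t .u * t .k * t .V - t .h * t .V ^ 2 - t .u ^ 2 * slope ε₀ ε₁ t

/-- The three equations of the phase space and the equation `F = 0` in the blow-up coordinates,
completed by a further equation `f = 0`. -/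
def system (a b : ℝ) (f : (Coord → ℝ) → ℝ) (t : Coord → ℝ) : Fin 5 → ℝ :=
  ![t .ρ * t .g + t .u ^ 2 - t .v ^ 2 - (a ^ 2 - b ^ 2),
    t .ρ * t .h + 2 * t .u * t .v,
    t .ρ ^ 2 + t .g ^ 2 + t .h ^ 2 + 2 * t .u ^ 2 + 2 * t .v ^ 2 - 2 * (a ^ 2 + b ^ 2),
    t .u * t .U - t .v * t .V - t .ρ * t .k,
    f t]

theorem system_eq_zero_iff : system a b f t = 0 ↔
    t .ρ * t .g + t .u ^ 2 - t .v ^ 2 = a ^ 2 - b ^ 2 ∧ t .ρ * t .h + 2 * t .u * t .v = 0 ∧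
    t .ρ ^ 2 + t .g ^ 2 + t .h ^ 2 + 2 * t .u ^ 2 + 2 * t .v ^ 2 = 2 * (a ^ 2 + b ^ 2) ∧
    t .u * t .U - t .v * t .V = t .ρ * t .k ∧ f t = 0 := by
  simp only [system, funext_iff, Fin.forall_fin_succ]
  simp [sub_eq_zero]

theorem im_exp_mul_eq_slope (ε₀ ε₁ : ℝ) (t : Coord → ℝ) :
    (exp (t .θ * I) * (ε₀ + 2 * I * ε₁ * t .k - ε₁ ^ 2 * yCoord t)).im = slope ε₀ ε₁ t := by
  have hmul : exp (t .θ * I) * (ε₀ + 2 * I * ε₁ * t .k - ε₁ ^ 2 * yCoord t) =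
      exp (t .θ * I) * (ε₀ + (2 * ε₁ * t .k : ℝ) * I) - (ε₁ ^ 2 : ℝ) * (t .g + t .h * I) := by
    rw [← exp_mul_yCoord]
    push_cast
    ring
  rw [hmul, sub_im, im_ofReal_mul, mul_im, exp_ofReal_mul_I_re, exp_ofReal_mul_I_im, re_add_mul_I,
    im_add_mul_I, im_add_mul_I, slope]
  ring

theorem blowDown_mem_P6_iff : blowDown ε₁ t ∈ P6 a b ↔
    t .ρ * t .g + t .u ^ 2 - t .v ^ 2 = a ^ 2 - b ^ 2 ∧ t .ρ * t .h + 2 * t .u * t .v = 0 ∧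
    t .ρ ^ 2 + t .g ^ 2 + t .h ^ 2 + 2 * t .u ^ 2 + 2 * t .v ^ 2 = 2 * (a ^ 2 + b ^ 2) := by
  have hxyz : t .ρ * exp (t .θ * I) * yCoord t + (t .u + t .v * I) ^ 2 =
      (t .ρ * t .g + t .u ^ 2 - t .v ^ 2 : ℝ) + (t .ρ * t .h + 2 * t .u * t .v : ℝ) * I := by
    rw [mul_assoc, exp_mul_yCoord]
    push_cast
    linear_combination (t .v : ℂ) ^ 2 * I_sq
  have hexp : normSq (exp (t .θ * I)) = 1 := by
    rw [normSq_eq_norm_sq, norm_exp_ofReal_mul_I, one_pow]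
  have hnorm : normSq (t .ρ * exp (t .θ * I)) + normSq (yCoord t) + 2 * normSq (t .u + t .v * I) =
      t .ρ ^ 2 + t .g ^ 2 + t .h ^ 2 + 2 * t .u ^ 2 + 2 * t .v ^ 2 := by
    rw [yCoord, normSq_mul, normSq_mul, normSq_conj, hexp, normSq_ofReal, normSq_add_mul_I,
      normSq_add_mul_I]
    ring
  rw [mem_P6_iff, blowDown, x₁_ofComplex, y₁_ofComplex, z₁_ofComplex, hxyz, hnorm, rSq,
    Complex.ext_iff, re_add_mul_I, im_add_mul_I, ofReal_re, ofReal_im, and_assoc]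

theorem system_eq_zero_iff_mem_P6 (ε₁ : ℝ) : system a b f t = 0 ↔
    blowDown ε₁ t ∈ P6 a b ∧ t .u * t .U - t .v * t .V = t .ρ * t .k ∧ f t = 0 := by
  rw [system_eq_zero_iff, blowDown_mem_P6_iff, and_assoc, and_assoc]

theorem re_conj_mul_blowDown (h : blowDown ε₁ t ∈ P6 a b) :
    (conj (x₁ (blowDown ε₁ t)) * z₁ (blowDown ε₁ t) * w₁ (blowDown ε₁ t)).re =
      t .ρ * (t .u * t .U - t .v * t .V)
        - ε₁ * t .ρ * ((a ^ 2 - b ^ 2) * sin (t .θ) + t .ρ * (yCoord t).im) := by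
  have hz := (mem_P6_iff.1 h).1
  have he := exp_mul_I_mul_conj (t .θ)
  simp only [blowDown, x₁_ofComplex, y₁_ofComplex, z₁_ofComplex, w₁_ofComplex] at hz ⊢
  have hmul : conj (t .ρ * exp (t .θ * I)) * (t .u + t .v * I) *
      (exp (t .θ * I) * (t .U + t .V * I) - I * ε₁ * (t .u + t .v * I)) =
      t .ρ * ((t .u + t .v * I) * (t .U + t .V * I)
        - ε₁ * (I * (((a ^ 2 - b ^ 2 : ℝ) : ℂ) * conj (exp (t .θ * I)) - t .ρ * yCoord t))) := by
    rw [map_mul, conj_ofReal]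
    rw [rSq] at hz
    linear_combination
      (t .ρ * ((t .u + t .v * I) * (t .U + t .V * I)) + I * ε₁ * t .ρ ^ 2 * yCoord t : ℂ) * he -
        I * ε₁ * t .ρ * conj (exp (t .θ * I)) * hz
  rw [hmul, re_ofReal_mul, sub_re, re_ofReal_mul, I_mul_re, sub_im, im_ofReal_mul, im_ofReal_mul,
    conj_im, exp_ofReal_mul_I_im, mul_re, re_add_mul_I, im_add_mul_I, re_add_mul_I, im_add_mul_I]
  ring

theorem im_conj_sq_mul_ξ₁_blowDown (h : blowDown ε₁ t ∈ P6 a b) :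
    (conj (x₁ (blowDown ε₁ t)) ^ 2 * ξ₁ a b ε₀ ε₁ (blowDown ε₁ t)).im =
      t .ρ ^ 2 * totalF₁ ε₀ ε₁ t := by
  have he := exp_mul_I_mul_conj (t .θ)
  have hκ : (ε₀ - I * ε₁ * (2 * t .k - 2 * ε₁ * (yCoord t).im : ℝ) - ε₁ ^ 2 * yCoord t : ℂ) =
      conj (ε₀ + 2 * I * ε₁ * t .k - ε₁ ^ 2 * yCoord t) := by
    exact Complex.ext (by simp [← ofReal_pow, map_ofNat])
      (by simp [← ofReal_pow, map_ofNat]; ring)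
  have hmul : conj (t .ρ * exp (t .θ * I)) ^ 2 * ((exp (t .θ * I) * (t .U + t .V * I)) ^ 2 +
      t .ρ * exp (t .θ * I) * conj (ε₀ + 2 * I * ε₁ * t .k - ε₁ ^ 2 * yCoord t)) =
      (t .ρ ^ 2 : ℝ) * ((t .U + t .V * I) ^ 2 + t .ρ *
        conj (exp (t .θ * I) * (ε₀ + 2 * I * ε₁ * t .k - ε₁ ^ 2 * yCoord t))) := by
    rw [map_mul, map_mul _ (exp (t .θ * I)) (_ - _ * _), conj_ofReal, ofReal_pow]
    linear_combination (t .ρ ^ 2 * ((t .U + t .V * I) ^ 2 *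
      (conj (exp (t .θ * I)) * exp (t .θ * I) + 1) +
        t .ρ * conj (exp (t .θ * I)) * conj (ε₀ + 2 * I * ε₁ * t .k - ε₁ ^ 2 * yCoord t))) * he
  rw [ξ₁_eq h]
  simp only [blowDown, x₁_ofComplex, y₁_ofComplex, z₁_ofComplex, w₁_ofComplex, mom_two_ofComplex,
    sub_add_cancel]
  rw [hκ, hmul, im_ofReal_mul, add_im, im_ofReal_mul, conj_im, im_exp_mul_eq_slope, totalF₁,
    sq (_ + _ : ℂ), mul_im, re_add_mul_I, im_add_mul_I]
  ring

theorem blowDown_mem_criticalLocus_iff (hρ : t .ρ ≠ 0) :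
    blowDown ε₁ t ∈ criticalLocus a b ε₀ ε₁ ↔ system a b (totalF₁ ε₀ ε₁) t = 0 := by
  have hx : x₁ (blowDown ε₁ t) = t .ρ * exp (t .θ * I) := x₁_ofComplex ..
  have hx0 : x₁ (blowDown ε₁ t) ≠ 0 := by
    rw [hx]
    exact mul_ne_zero (ofReal_ne_zero.2 hρ) (Complex.exp_ne_zero _)
  have hnorm : normSq (x₁ (blowDown ε₁ t)) = t .ρ ^ 2 := by
    rw [hx, normSq_mul, normSq_eq_norm_sq (exp _), norm_exp_ofReal_mul_I, normSq_ofReal]; ring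
  have him : (x₁ (blowDown ε₁ t)).im = t .ρ * sin (t .θ) := by
    rw [hx, im_ofReal_mul, exp_ofReal_mul_I_im]
  have hm : mom (blowDown ε₁ t) 2 = 2 * t .k - 2 * ε₁ * (yCoord t).im := rfl
  rw [mem_criticalLocus_iff, system_eq_zero_iff_mem_P6 ε₁]
  refine and_congr_right fun h => ?_
  rw [re_conj_mul_blowDown h, im_conj_sq_mul_ξ₁_blowDown h, hnorm, him, hm,
    mul_eq_zero_iff_left (pow_ne_zero 2 hρ), and_iff_right hx0]
  refine and_congr_left' ⟨fun h => ?_, fun h => ?_⟩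
  · exact mul_left_cancel₀ hρ (by linear_combination -h / 2)
  · linear_combination -2 * t .ρ * h

theorem sq_mul_totalF₁ (ε₀ ε₁ : ℝ) (t : Coord → ℝ) : t .u ^ 2 * totalF₁ ε₀ ε₁ t =
    2 * t .u * t .V * (t .u * t .U - t .v * t .V - t .ρ * t .k)
      + t .V ^ 2 * (t .ρ * t .h + 2 * t .u * t .v) + t .ρ * strictF₁ ε₀ ε₁ t := by
  rw [totalF₁, strictF₁]; ring

/-- The strict transform of the critical set under the blow-up of `ℝ⁹` along `x₁ = 0`. -/
def blowUp (a b ε₀ ε₁ : ℝ) : Set (Coord → ℝ) :=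
  {t | system a b (totalF₁ ε₀ ε₁) t = 0 ∧ system a b (strictF₁ ε₀ ε₁) t = 0}

theorem mem_blowUp_iff_of_ρ_ne_zero (hρ : t .ρ ≠ 0) :
    t ∈ blowUp a b ε₀ ε₁ ↔ system a b (totalF₁ ε₀ ε₁) t = 0 := by
  refine and_iff_left_of_imp fun h => ?_
  obtain ⟨h₁, h₂, h₃, h₄, h₅⟩ := system_eq_zero_iff.1 h
  have hstrict : t .ρ * strictF₁ ε₀ ε₁ t = 0 := by
    linear_combination t .u ^ 2 * h₅ - 2 * t .u * t .V * h₄ - t .V ^ 2 * h₂ -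
      sq_mul_totalF₁ ε₀ ε₁ t
  exact system_eq_zero_iff.2 ⟨h₁, h₂, h₃, h₄, (mul_eq_zero.1 hstrict).resolve_left hρ⟩

theorem mem_blowUp_iff_of_u_ne_zero (hu : t .u ≠ 0) :
    t ∈ blowUp a b ε₀ ε₁ ↔ system a b (strictF₁ ε₀ ε₁) t = 0 := by
  refine and_iff_right_of_imp fun h => ?_
  obtain ⟨h₁, h₂, h₃, h₄, h₅⟩ := system_eq_zero_iff.1 h
  have htotal : t .u ^ 2 * totalF₁ ε₀ ε₁ t = 0 := by
    linear_combination t .ρ * h₅ + 2 * t .u * t .V * h₄ + t .V ^ 2 * h₂ +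
      sq_mul_totalF₁ ε₀ ε₁ t
  exact system_eq_zero_iff.2
    ⟨h₁, h₂, h₃, h₄, (mul_eq_zero.1 htotal).resolve_left (pow_ne_zero 2 hu)⟩

theorem eq_zero_of_mem_blowUp_of_ρ_eq_zero (hb : 0 < b) (hab : b < a)
    (ht : t ∈ blowUp a b ε₀ ε₁) (hρ : t .ρ = 0) :
    t .u ≠ 0 ∧ t .v = 0 ∧ t .U = 0 ∧ t .g ^ 2 + t .h ^ 2 = 4 * b ^ 2 := by
  obtain ⟨h₁, h₂, h₃, h₄, -⟩ := system_eq_zero_iff.1 ht.1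
  rw [hρ] at h₁ h₂ h₃ h₄
  have hu : t .u ≠ 0 := fun hu => by
    rw [hu] at h₁
    nlinarith [sq_nonneg (t .v)]
  have hv : t .v = 0 := by simpa [hu] using h₂
  have hU : t .U = 0 := by simpa [hu, hv] using h₄
  rw [hv] at h₁ h₃
  exact ⟨hu, hv, hU, by linear_combination h₃ - 2 * h₁⟩

theorem slope_rate_pos (hb : 0 < b) (hab : b < a) (hε : ε₁ ^ 2 * (2 * a) < ε₀)
    (ht : t ∈ blowUp a b ε₀ ε₁) {p : ℝ} (hp : p ^ 2 ≤ t .g ^ 2 + t .h ^ 2) :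
    0 < ε₀ - ε₁ ^ 2 * p := by
  obtain ⟨-, -, h₃, -, -⟩ := system_eq_zero_iff.1 ht.1
  have hpa : p < 2 * a := by
    refine lt_of_pow_lt_pow_left₀ 2 (by linarith) ?_
    nlinarith [sq_nonneg (t .ρ), sq_nonneg (t .u), sq_nonneg (t .v)]
  nlinarith [mul_le_mul_of_nonneg_left hpa.le (sq_nonneg ε₁)]

end System

section Derivative

variable {a b : ℝ} {f : (Coord → ℝ) → ℝ} {n : ℕ∞ω}

theorem fderiv_apply_eq_of_hasLineDerivAt {𝕜 X Y : Type*} [NontriviallyNormedField 𝕜]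
    [NormedAddCommGroup X] [NormedSpace 𝕜 X] [NormedAddCommGroup Y] [NormedSpace 𝕜 Y]
    {f : X → Y} {p v : X} {c : Y} (hf : DifferentiableAt 𝕜 f p) (h : HasLineDerivAt 𝕜 f c p v) :
    fderiv 𝕜 f p v = c := by
  rw [← hf.lineDeriv_eq_fderiv, h.lineDeriv]

theorem hasDerivAt_add_smul_apply {ι 𝕜 : Type*} [NontriviallyNormedField 𝕜] (p v : ι → 𝕜)
    (i : ι) : HasDerivAt (fun s : 𝕜 => (p + s • v) i) (v i) 0 := by
  simpa using ((hasDerivAt_id (0 : 𝕜)).mul_const (v i)).const_add (p i)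

theorem contDiff_slope (ε₀ ε₁ : ℝ) : ContDiff ℝ n (slope ε₀ ε₁) := by
  have := contDiff_apply ℝ ℝ (n := n) (ι := Coord)
  unfold slope
  fun_prop

theorem contDiff_totalF₁ (ε₀ ε₁ : ℝ) : ContDiff ℝ n (totalF₁ ε₀ ε₁) := by
  have := contDiff_apply ℝ ℝ (n := n) (ι := Coord)
  have := contDiff_slope ε₀ ε₁ (n := n)
  unfold totalF₁
  fun_prop

theorem contDiff_strictF₁ (ε₀ ε₁ : ℝ) : ContDiff ℝ n (strictF₁ ε₀ ε₁) := by
  have := contDiff_apply ℝ ℝ (n := n) (ι := Coord)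
  have := contDiff_slope ε₀ ε₁ (n := n)
  unfold strictF₁
  fun_prop

theorem contDiff_system (hf : ContDiff ℝ n f) : ContDiff ℝ n (system a b f) := by
  have := contDiff_apply ℝ ℝ (n := n) (ι := Coord)
  unfold system
  refine contDiff_pi.2 fun i => ?_
  fin_cases i <;> dsimp <;> fun_prop

theorem fderiv_slope (ε₀ ε₁ : ℝ) (t d : Coord → ℝ) : fderiv ℝ (slope ε₀ ε₁) t d =
    (ε₀ * cos (t .θ) - 2 * ε₁ * t .k * sin (t .θ)) * d .θ + 2 * ε₁ * cos (t .θ) * d .k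
      - ε₁ ^ 2 * d .h := by
  refine fderiv_apply_eq_of_hasLineDerivAt
    ((contDiff_slope ε₀ ε₁).differentiable one_ne_zero _) ?_
  have hd := hasDerivAt_add_smul_apply t d
  refine ((((hd .θ).sin.const_mul ε₀).add (((hd .k).const_mul (2 * ε₁)).mul (hd .θ).cos)).sub
    ((hd .h).const_mul (ε₁ ^ 2))).congr_deriv ?_
  simp only [zero_smul, add_zero]
  ring

theorem fderiv_totalF₁ (ε₀ ε₁ : ℝ) (t d : Coord → ℝ) : fderiv ℝ (totalF₁ ε₀ ε₁) t d =
    2 * (t .V * d .U + t .U * d .V) - slope ε₀ ε₁ t * d .ρ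
      - t .ρ * fderiv ℝ (slope ε₀ ε₁) t d := by
  refine fderiv_apply_eq_of_hasLineDerivAt
    ((contDiff_totalF₁ ε₀ ε₁).differentiable one_ne_zero _) ?_
  have hd := hasDerivAt_add_smul_apply t d
  have hs := (((contDiff_slope ε₀ ε₁).differentiable one_ne_zero t).hasFDerivAt.hasLineDerivAt d)
  refine ((((hd .U).const_mul 2).mul (hd .V)).sub ((hd .ρ).mul hs)).congr_deriv ?_
  simp only [zero_smul, add_zero]
  ring

theorem fderiv_strictF₁ (ε₀ ε₁ : ℝ) (t d : Coord → ℝ) : fderiv ℝ (strictF₁ ε₀ ε₁) t d =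
    2 * (t .k * t .V - t .u * slope ε₀ ε₁ t) * d .u + 2 * t .u * t .V * d .k
      + 2 * (t .u * t .k - t .h * t .V) * d .V - t .V ^ 2 * d .h
      - t .u ^ 2 * fderiv ℝ (slope ε₀ ε₁) t d := by
  refine fderiv_apply_eq_of_hasLineDerivAt
    ((contDiff_strictF₁ ε₀ ε₁).differentiable one_ne_zero _) ?_
  have hd := hasDerivAt_add_smul_apply t d
  have hs := (((contDiff_slope ε₀ ε₁).differentiable one_ne_zero t).hasFDerivAt.hasLineDerivAt d)
  refine (((((hd .u).const_mul 2).mul (hd .k)).mul (hd .V)).sub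
    ((hd .h).mul ((hd .V).pow 2)) |>.sub (((hd .u).pow 2).mul hs)).congr_deriv ?_
  simp only [zero_smul, add_zero, Pi.mul_apply, Pi.pow_apply]
  ring

theorem fderiv_system (hf : Differentiable ℝ f) (t d : Coord → ℝ) :
    fderiv ℝ (system a b f) t d =
      ![t .g * d .ρ + t .ρ * d .g + 2 * t .u * d .u - 2 * t .v * d .v,
        t .h * d .ρ + t .ρ * d .h + 2 * t .v * d .u + 2 * t .u * d .v,
        2 * t .ρ * d .ρ + 2 * t .g * d .g + 2 * t .h * d .h + 4 * t .u * d .u + 4 * t .v * d .v,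
        t .U * d .u + t .u * d .U - t .V * d .v - t .v * d .V - t .k * d .ρ - t .ρ * d .k,
        fderiv ℝ f t d] := by
  have hd := hasDerivAt_add_smul_apply t d
  have hsys : DifferentiableAt ℝ (system a b f) t := by
    refine differentiableAt_pi.2 fun i => ?_
    fin_cases i <;> dsimp [system] <;> fun_prop
  refine fderiv_apply_eq_of_hasLineDerivAt hsys (hasDerivAt_pi.2 fun i => ?_)
  match i with
  | 0 =>
    refine (((hd .ρ).mul (hd .g)).add ((hd .u).pow 2) |>.sub ((hd .v).pow 2)
      |>.sub_const _).congr_deriv ?_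
    simp only [zero_smul, add_zero, Matrix.cons_val]
    ring
  | 1 =>
    refine (((hd .ρ).mul (hd .h)).add (((hd .u).const_mul 2).mul (hd .v))).congr_deriv ?_
    simp only [zero_smul, add_zero, Matrix.cons_val]
    ring
  | 2 =>
    refine (((hd .ρ).pow 2).add ((hd .g).pow 2) |>.add ((hd .h).pow 2)
      |>.add (((hd .u).pow 2).const_mul 2)
      |>.add (((hd .v).pow 2).const_mul 2) |>.sub_const _).congr_deriv ?_
    simp only [zero_smul, add_zero, Matrix.cons_val]
    ring
  | 3 =>
    refine (((hd .u).mul (hd .U)).sub ((hd .v).mul (hd .V))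
      |>.sub ((hd .ρ).mul (hd .k))).congr_deriv ?_
    simp only [zero_smul, add_zero, Matrix.cons_val]
    ring
  | 4 => exact (hf t).hasFDerivAt.hasLineDerivAt d

end Derivative

theorem Coord.forall {p : Coord → Prop} : (∀ i, p i) ↔
    p .θ ∧ p .ρ ∧ p .u ∧ p .v ∧ p .g ∧ p .h ∧ p .U ∧ p .V ∧ p .k :=
  ⟨fun h => ⟨h _, h _, h _, h _, h _, h _, h _, h _, h _⟩, fun h i => by cases i <;> tauto⟩

section Surjectivity

variable {a b ε₀ ε₁ : ℝ} {t : Coord → ℝ} {f : (Coord → ℝ) → ℝ}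

theorem dotProduct_fderiv_system (hf : Differentiable ℝ f) (c : Fin 5 → ℝ) (t d : Coord → ℝ) :
    c ⬝ᵥ fderiv ℝ (system a b f) t d =
      c 0 * (t .g * d .ρ + t .ρ * d .g + 2 * t .u * d .u - 2 * t .v * d .v) +
      c 1 * (t .h * d .ρ + t .ρ * d .h + 2 * t .v * d .u + 2 * t .u * d .v) +
      c 2 * (2 * t .ρ * d .ρ + 2 * t .g * d .g + 2 * t .h * d .h + 4 * t .u * d .u
        + 4 * t .v * d .v) +
      c 3 * (t .U * d .u + t .u * d .U - t .V * d .v - t .v * d .V - t .k * d .ρ - t .ρ * d .k) +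
      c 4 * fderiv ℝ f t d := by
  rw [fderiv_system hf, dotProduct, Fin.sum_univ_five]
  rfl

theorem ε₀_mul_cos_ne (hb : 0 < b) (hab : b < a) (hε : ε₁ ^ 2 * (2 * a) < ε₀)
    (ht : t ∈ blowUp a b ε₀ ε₁) (hk : t .k = ε₁ * cos (t .θ) * t .h)
    (hσ : slope ε₀ ε₁ t = ε₁ ^ 2 * cos (t .θ) ^ 2 * t .h) :
    ε₀ * cos (t .θ) ≠ 2 * ε₁ * t .k * sin (t .θ) := by
  intro hθ
  have hcs := Real.sin_sq_add_cos_sq (t .θ)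
  have hrate : 0 < ε₀ - ε₁ ^ 2 * (t .h * sin (t .θ)) := by
    refine slope_rate_pos hb hab hε ht ?_
    nlinarith [mul_nonneg (sq_nonneg (t .h)) (sq_nonneg (cos (t .θ))), sq_nonneg (t .g)]
  have hε₀ : 0 < ε₀ := by nlinarith [sq_nonneg ε₁]
  have hsin : sin (t .θ) * (ε₀ - ε₁ ^ 2 * (t .h * sin (t .θ))) = 0 := by
    rw [slope] at hσ
    linear_combination hσ - 2 * ε₁ * cos (t .θ) * hk - ε₁ ^ 2 * t .h * hcs
  have hs : sin (t .θ) = 0 := (mul_eq_zero.1 hsin).resolve_right hrate.ne'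
  have hc : cos (t .θ) = 0 := by simpa [hs, hε₀.ne'] using hθ
  simp [hs, hc] at hcs

theorem multipliers_P6_eq_zero (hb : 0 < b) (hab : b < a) (ht : system a b f t = 0)
    (hρ : t .ρ ≠ 0) {c₀ c₁ c₂ : ℝ} (hg : t .ρ * c₀ + 2 * t .g * c₂ = 0)
    (hh : t .ρ * c₁ + 2 * t .h * c₂ = 0)
    (hu : 2 * t .u * c₀ + 2 * t .v * c₁ + 4 * t .u * c₂ = 0)
    (hv : -2 * t .v * c₀ + 2 * t .u * c₁ + 4 * t .v * c₂ = 0)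
    (hρ' : t .g * c₀ + t .h * c₁ + 2 * t .ρ * c₂ = 0) : c₀ = 0 ∧ c₁ = 0 ∧ c₂ = 0 := by
  obtain ⟨h₁, h₂, h₃, -, -⟩ := system_eq_zero_iff.1 ht
  have hc₂ : c₂ = 0 := by
    by_contra hc₂
    have hnorm : t .ρ ^ 2 = t .g ^ 2 + t .h ^ 2 := mul_left_cancel₀ hc₂ (by
      linear_combination t .ρ / 2 * hρ' - t .g / 2 * hg - t .h / 2 * hh)
    have hv₀ : t .v = 0 := by
      have hmul : t .v * (t .ρ ^ 2 + (a ^ 2 - b ^ 2) + t .u ^ 2 + t .v ^ 2) = 0 :=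
        mul_left_cancel₀ hc₂ (by
          linear_combination t .ρ ^ 2 / 4 * hv + t .ρ * t .v / 2 * hg - t .ρ * t .u / 2 * hh
            - c₂ * t .v * h₁ + c₂ * t .u * h₂)
      refine (mul_eq_zero.1 hmul).resolve_right (ne_of_gt ?_)
      nlinarith [sq_nonneg (t .ρ), sq_nonneg (t .u), sq_nonneg (t .v)]
    have hu₀ : t .u = 0 := by
      have hmul : t .u * b ^ 2 = 0 := mul_left_cancel₀ hc₂ (by
        rw [hv₀] at hu h₁ h₃
        linear_combination t .ρ ^ 2 / 8 * hu - t .ρ * t .u / 4 * hg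
          + c₂ * t .u / 2 * h₁ - c₂ * t .u / 4 * h₃ - c₂ * t .u / 4 * hnorm)
      exact (mul_eq_zero.1 hmul).resolve_right (pow_pos hb 2).ne'
    rw [hu₀, hv₀] at h₁ h₂ h₃
    have hh₀ : t .h = 0 := by simpa [hρ] using h₂
    have hzero : b ^ 2 * a ^ 2 = 0 := by
      rw [hh₀] at hnorm h₃
      have hg₂ : t .g ^ 2 = a ^ 2 + b ^ 2 := by linear_combination h₃ / 2 - hnorm / 2
      have hρ₂ : t .ρ ^ 2 = a ^ 2 + b ^ 2 := by linear_combination hnorm + hg₂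
      linear_combination (t .ρ * t .g + (a ^ 2 - b ^ 2)) / 4 * h₁ - t .ρ ^ 2 / 4 * hg₂
        - (a ^ 2 + b ^ 2) / 4 * hρ₂
    have := mul_pos (pow_pos hb 2) (pow_pos (hb.trans hab) 2)
    exact this.ne' hzero
  rw [hc₂, mul_zero, add_zero] at hg hh
  exact ⟨(mul_eq_zero.1 hg).resolve_left hρ, (mul_eq_zero.1 hh).resolve_left hρ, hc₂⟩

theorem multipliers_totalF₁_eq_zero (hb : 0 < b) (hab : b < a) (hε : ε₁ ^ 2 * (2 * a) < ε₀)
    (ht : t ∈ blowUp a b ε₀ ε₁) (hρ : t .ρ ≠ 0) {c₃ c₄ : ℝ}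
    (hk : c₃ + 2 * ε₁ * cos (t .θ) * c₄ = 0)
    (hU : t .u * c₃ + 2 * t .V * c₄ = 0) (hV : -t .v * c₃ + 2 * t .U * c₄ = 0)
    (hθ : c₄ * (ε₀ * cos (t .θ) - 2 * ε₁ * t .k * sin (t .θ)) = 0) : c₃ = 0 ∧ c₄ = 0 := by
  have hc₄ : c₄ = 0 := by
    by_contra hc₄
    obtain ⟨-, h₂, -, h₄, h₅⟩ := system_eq_zero_iff.1 ht.1
    rw [totalF₁] at h₅
    have hV₀ : t .V = ε₁ * cos (t .θ) * t .u := mul_left_cancel₀ hc₄ (by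
      linear_combination hU / 2 - t .u / 2 * hk)
    have hU₀ : t .U = -ε₁ * cos (t .θ) * t .v := mul_left_cancel₀ hc₄ (by
      linear_combination hV / 2 + t .v / 2 * hk)
    refine ε₀_mul_cos_ne hb hab hε ht (mul_left_cancel₀ hρ ?_)
      (mul_left_cancel₀ hρ ?_) (sub_eq_zero.1 ((mul_eq_zero.1 hθ).resolve_left hc₄))
    · linear_combination t .u * hU₀ - t .v * hV₀ - h₄ - ε₁ * cos (t .θ) * h₂
    · linear_combination 2 * t .V * hU₀ - 2 * ε₁ * cos (t .θ) * t .v * hV₀ - h₅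
        - ε₁ ^ 2 * cos (t .θ) ^ 2 * h₂
  rw [hc₄, mul_zero, add_zero] at hk
  exact ⟨hk, hc₄⟩

theorem multiplier_strictF₁_eq_zero (hb : 0 < b) (hab : b < a) (hε : ε₁ ^ 2 * (2 * a) < ε₀)
    (ht : t ∈ blowUp a b ε₀ ε₁) (hu : t .u ≠ 0) {c₄ : ℝ}
    (hk : c₄ * (t .V - ε₁ * cos (t .θ) * t .u) = 0)
    (hV : c₄ * (t .u * t .k - t .h * t .V) = 0)
    (hθ : c₄ * (ε₀ * cos (t .θ) - 2 * ε₁ * t .k * sin (t .θ)) = 0) : c₄ = 0 := by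
  by_contra hc₄
  have h₅ := (system_eq_zero_iff.1 ht.2).2.2.2.2
  have hV₀ : t .V = ε₁ * cos (t .θ) * t .u :=
    sub_eq_zero.1 ((mul_eq_zero.1 hk).resolve_left hc₄)
  have hk₀ : t .k = ε₁ * cos (t .θ) * t .h := mul_left_cancel₀ (mul_ne_zero hc₄ hu) (by
    linear_combination hV + c₄ * t .h * hV₀)
  refine ε₀_mul_cos_ne hb hab hε ht hk₀ (mul_left_cancel₀ (pow_ne_zero 2 hu) ?_)
    (sub_eq_zero.1 ((mul_eq_zero.1 hθ).resolve_left hc₄))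
  rw [strictF₁, hk₀, hV₀] at h₅
  linear_combination -h₅

theorem surjective_fderiv_system_totalF₁ (hb : 0 < b) (hab : b < a)
    (hε : ε₁ ^ 2 * (2 * a) < ε₀) (ht : t ∈ blowUp a b ε₀ ε₁) (hρ : t .ρ ≠ 0) :
    Function.Surjective (fderiv ℝ (system a b (totalF₁ ε₀ ε₁)) t) := by
  rw [← ContinuousLinearMap.coe_coe, ← LinearMap.range_eq_top, LinearMap.range_eq_map]
  refine map_eq_top_of_forall_dotProduct fun c hc => ?_
  have hpartial (i : Coord) := hc (Pi.single i 1) trivial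
  simp only [ContinuousLinearMap.coe_coe, fderiv_totalF₁, fderiv_slope, Pi.single_apply,
    dotProduct_fderiv_system ((contDiff_totalF₁ ε₀ ε₁).differentiable one_ne_zero), Coord.forall,
    reduceCtorEq, if_true, if_false, mul_zero, mul_one, add_zero, zero_add, sub_zero, zero_sub]
    at hpartial
  obtain ⟨hθ, hρ', hu, hv, hg, hh, hU, hV, hk⟩ := hpartial
  obtain ⟨hc₃, hc₄⟩ := multipliers_totalF₁_eq_zero hb hab hε ht hρ (c₃ := c 3) (c₄ := c 4)
    (mul_left_cancel₀ hρ (by linear_combination -hk)) (by linear_combination hU)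
    (by linear_combination hV) (mul_left_cancel₀ hρ (by linear_combination -hθ))
  simp only [hc₃, hc₄] at hg hh hu hv hρ'
  obtain ⟨hc₀, hc₁, hc₂⟩ := multipliers_P6_eq_zero hb hab ht.1 hρ (c₀ := c 0) (c₁ := c 1)
    (c₂ := c 2) (by linear_combination hg) (by linear_combination hh) (by linear_combination hu)
    (by linear_combination hv) (by linear_combination hρ')
  ext i
  fin_cases i <;> assumption

theorem map_fderiv_system_strictF₁_eq_top (hb : 0 < b) (hab : b < a)
    (hε : ε₁ ^ 2 * (2 * a) < ε₀) (ht : t ∈ blowUp a b ε₀ ε₁) (hρ : t .ρ = 0) :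
    (LinearMap.ker (LinearMap.proj .ρ : (Coord → ℝ) →ₗ[ℝ] ℝ)).map
      (fderiv ℝ (system a b (strictF₁ ε₀ ε₁)) t : (Coord → ℝ) →ₗ[ℝ] Fin 5 → ℝ) = ⊤ := by
  obtain ⟨hu₀, hv₀, -, hgh⟩ := eq_zero_of_mem_blowUp_of_ρ_eq_zero hb hab ht hρ
  refine map_eq_top_of_forall_dotProduct fun c hc => ?_
  have hpartial (i : Coord) (hi : i ≠ .ρ) := hc (Pi.single i 1) (Pi.single_eq_of_ne' hi 1)
  simp only [ContinuousLinearMap.coe_coe, fderiv_strictF₁, fderiv_slope, Pi.single_apply,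
    dotProduct_fderiv_system ((contDiff_strictF₁ ε₀ ε₁).differentiable one_ne_zero), Coord.forall,
    hρ, hv₀, ne_eq, reduceCtorEq, not_true_eq_false, not_false_eq_true, forall_const,
    IsEmpty.forall_iff, if_true, if_false, mul_zero, zero_mul, mul_one, add_zero, zero_add,
    sub_zero, zero_sub] at hpartial
  obtain ⟨hθ, -, hu, hv, hg, hh, hU, hV, hk⟩ := hpartial
  have hc₄ : c 4 = 0 := multiplier_strictF₁_eq_zero hb hab hε ht hu₀
    (mul_left_cancel₀ hu₀ (by linear_combination hk / 2)) (by linear_combination hV / 2)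
    (mul_left_cancel₀ (pow_ne_zero 2 hu₀) (by linear_combination -hθ))
  have hc₃ : c 3 = 0 := mul_left_cancel₀ hu₀ (by linear_combination hU)
  have hc₂ : c 2 = 0 := mul_left_cancel₀ (hgh.trans_ne (by positivity)) (by
    rw [hc₄] at hh
    linear_combination t .g / 2 * hg + t .h / 2 * hh)
  have hc₁ : c 1 = 0 := mul_left_cancel₀ hu₀ (by
    rw [hc₃] at hv
    linear_combination hv / 2)
  have hc₀ : c 0 = 0 := mul_left_cancel₀ hu₀ (by
    rw [hc₂, hc₃, hc₄] at hu
    linear_combination hu / 2)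
  ext i
  fin_cases i <;> assumption

end Surjectivity

section Image

variable {a b ε₀ ε₁ : ℝ} {t : Coord → ℝ}

theorem isClosed_blowUp (a b ε₀ ε₁ : ℝ) : IsClosed (blowUp a b ε₀ ε₁) :=
  have htotal := (contDiff_system (a := a) (b := b) (n := 0) (contDiff_totalF₁ ε₀ ε₁)).continuous
  have hstrict := (contDiff_system (a := a) (b := b) (n := 0) (contDiff_strictF₁ ε₀ ε₁)).continuous
  (isClosed_eq htotal continuous_const).inter (isClosed_eq hstrict continuous_const)

/-- The points of blow-up space whose angle `θ` differs from `θ₀` by at most `π / 2`. Since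
`(θ, ρ)` and `(θ + π, -ρ)` describe the same `x₁`, it contains preimages of all points of `ℝ⁹`. -/
def angleStrip (θ₀ : ℝ) : Set (Coord → ℝ) :=
  {t | t .θ ∈ Set.Icc (θ₀ - π / 2) (θ₀ + π / 2)}

theorem isClosedMap_domRestrict_blowDown (ε₁ θ₀ : ℝ) :
    IsClosedMap ((angleStrip θ₀).domRestrict (blowDown ε₁)) := by
  let φ : angleStrip θ₀ → Set.Icc (θ₀ - π / 2) (θ₀ + π / 2) × V9 :=
    fun t => (⟨t.1 .θ, t.2⟩, blowDown ε₁ t)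
  let ψ : Set.Icc (θ₀ - π / 2) (θ₀ + π / 2) × V9 → angleStrip θ₀ :=
    fun p => ⟨blowUpCoord ε₁ p.1 p.2, p.1.2⟩
  have hφ : Continuous φ :=
    (((continuous_apply Coord.θ).comp continuous_subtype_val).subtype_mk _).prodMk
      ((contDiff_blowDown ε₁).continuous.comp continuous_subtype_val)
  have hψ : Continuous ψ :=
    ((continuous_blowUpCoord ε₁).comp (by fun_prop : Continuous fun p :
      Set.Icc (θ₀ - π / 2) (θ₀ + π / 2) × V9 => ((p.1 : ℝ), p.2))).subtype_mk _
  have hψφ : Function.LeftInverse ψ φ := fun t => Subtype.ext (blowUpCoord_blowDown ε₁ t)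
  exact isClosedMap_snd_of_compactSpace.comp (hψφ.isClosedEmbedding hψ hφ).isClosedMap

theorem criticalLocus_subset_image (θ₀ : ℝ) :
    criticalLocus a b ε₀ ε₁ ⊆ blowDown ε₁ '' (blowUp a b ε₀ ε₁ ∩ angleStrip θ₀) := by
  intro q hq
  obtain ⟨τ, hτ, him⟩ := exists_im_exp_mul_I_mul_eq_zero θ₀ (x₂ q)
  have hdown : blowDown ε₁ (blowUpCoord ε₁ τ q) = q := blowDown_blowUpCoord him
  have hρ : blowUpCoord ε₁ τ q .ρ ≠ 0 := fun hρ => by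
    refine (mem_criticalLocus_iff.1 hq).2.1 ?_
    rw [← hdown, blowDown, x₁_ofComplex, hρ, ofReal_zero, zero_mul]
  refine ⟨blowUpCoord ε₁ τ q, ⟨?_, hτ⟩, hdown⟩
  rwa [mem_blowUp_iff_of_ρ_ne_zero hρ, ← blowDown_mem_criticalLocus_iff hρ, hdown]

theorem mem_closure_of_mem_blowUp_of_ρ_eq_zero (hb : 0 < b) (hab : b < a)
    (hε : ε₁ ^ 2 * (2 * a) < ε₀) (ht : t ∈ blowUp a b ε₀ ε₁) (hρ : t .ρ = 0) :
    t ∈ closure (blowUp a b ε₀ ε₁ ∩ {s | s .ρ ≠ 0}) := by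
  let f : (Coord → ℝ) → ℝ × (Fin 5 → ℝ) := fun s => (s .ρ, system a b (strictF₁ ε₀ ε₁) s)
  have hsys := contDiff_system (a := a) (b := b) (n := 1) (contDiff_strictF₁ ε₀ ε₁)
  have hf : HasStrictFDerivAt f ((ContinuousLinearMap.proj .ρ).prod
      (fderiv ℝ (system a b (strictF₁ ε₀ ε₁)) t)) t :=
    (ContinuousLinearMap.proj (R := ℝ) (φ := fun _ : Coord => ℝ) .ρ).hasStrictFDerivAt.prodMk
      (hsys.contDiffAt.hasStrictFDerivAt one_ne_zero)
  have hrange : ((ContinuousLinearMap.proj .ρ).prod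
      (fderiv ℝ (system a b (strictF₁ ε₀ ε₁)) t)).range = ⊤ := by
    have hmap := map_fderiv_system_strictF₁_eq_top hb hab hε ht hρ
    have hL := top_le_iff.1 (hmap.ge.trans LinearMap.map_le_range)
    refine (LinearMap.range_prod_eq ((LinearMap.map_eq_top_iff hL).1 hmap)).trans ?_
    rw [hL, ← Submodule.prod_top]
    exact congrArg (Submodule.prod · ⊤) (LinearMap.range_eq_top.2 (LinearMap.proj_surjective _))
  have hzero : f t ∈ closure ({0}ᶜ ×ˢ {0}) := by
    rw [closure_prod_eq, (dense_compl_singleton (0 : ℝ)).closure_eq]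
    exact ⟨trivial, subset_closure ht.2⟩
  have hu : IsOpen {s : Coord → ℝ | s .u ≠ 0} :=
    isOpen_ne_fun (continuous_apply _) continuous_const
  refine closure_mono ?_ (hu.inter_closure
    ⟨(eq_zero_of_mem_blowUp_of_ρ_eq_zero hb hab ht hρ).1,
      mem_closure_preimage_of_surjective hf hrange hzero⟩)
  rintro s ⟨hsu, hsρ, hs⟩
  exact ⟨(mem_blowUp_iff_of_u_ne_zero hsu).2 hs, hsρ⟩

theorem image_blowUp_subset_M2 (hb : 0 < b) (hab : b < a) (hε : ε₁ ^ 2 * (2 * a) < ε₀) :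
    blowDown ε₁ '' blowUp a b ε₀ ε₁ ⊆ M2 a b ε₀ ε₁ := by
  have hreg : ∀ s ∈ blowUp a b ε₀ ε₁ ∩ {s | s .ρ ≠ 0},
      blowDown ε₁ s ∈ criticalLocus a b ε₀ ε₁ := fun s hs =>
    (blowDown_mem_criticalLocus_iff hs.2).2 hs.1.1
  rintro _ ⟨t, ht, rfl⟩
  by_cases hρ : t .ρ = 0
  · exact map_mem_closure (contDiff_blowDown ε₁).continuous
      (mem_closure_of_mem_blowUp_of_ρ_eq_zero hb hab hε ht hρ) hreg
  · exact subset_closure (hreg t ⟨ht, hρ⟩)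

theorem M2_eq_image_inter_angleStrip (hb : 0 < b) (hab : b < a) (hε : ε₁ ^ 2 * (2 * a) < ε₀)
    (θ₀ : ℝ) : M2 a b ε₀ ε₁ = blowDown ε₁ '' (blowUp a b ε₀ ε₁ ∩ angleStrip θ₀) := by
  refine (closure_minimal (criticalLocus_subset_image θ₀) ?_).antisymm
    ((Set.image_mono Set.inter_subset_left).trans (image_blowUp_subset_M2 hb hab hε))
  have himage := isClosedMap_domRestrict_blowDown ε₁ θ₀ _
    ((isClosed_blowUp a b ε₀ ε₁).preimage continuous_subtype_val)
  rwa [Set.domRestrict_eq, Set.image_comp, Subtype.image_preimage_val,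
    Set.inter_comm] at himage

theorem M2_eq_image (hb : 0 < b) (hab : b < a) (hε : ε₁ ^ 2 * (2 * a) < ε₀) :
    M2 a b ε₀ ε₁ = blowDown ε₁ '' blowUp a b ε₀ ε₁ :=
  ((M2_eq_image_inter_angleStrip hb hab hε 0).trans_subset
    (Set.image_mono Set.inter_subset_left)).antisymm (image_blowUp_subset_M2 hb hab hε)

end Image

section Uniqueness

variable {a b ε₀ ε₁ : ℝ} {s t : Coord → ℝ}

theorem ε₀_add_sub_ne_zero (hb : 0 < b) (hab : b < a) (hε : ε₁ ^ 2 * (2 * a) < ε₀)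
    (ht : t ∈ blowUp a b ε₀ ε₁) :
    (ε₀ + 2 * I * ε₁ * t .k - ε₁ ^ 2 * yCoord t : ℂ) ≠ 0 := by
  have hnorm : normSq (yCoord t) = t .g ^ 2 + t .h ^ 2 := by
    rw [yCoord, normSq_mul, normSq_conj, normSq_eq_norm_sq (exp _), norm_exp_ofReal_mul_I,
      normSq_add_mul_I, one_pow, one_mul]
  have hre : (ε₀ + 2 * I * ε₁ * t .k - ε₁ ^ 2 * yCoord t : ℂ).re =
      ε₀ - ε₁ ^ 2 * (yCoord t).re := by
    simp [← ofReal_pow]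
  have hpos : 0 < ε₀ - ε₁ ^ 2 * (yCoord t).re := by
    refine slope_rate_pos hb hab hε ht ?_
    rw [← hnorm, sq]
    exact re_sq_le_normSq _
  exact fun h => hpos.ne' (by rw [← hre, h, zero_re])

theorem slope_eq_zero_of_mem_blowUp (ht : t ∈ blowUp a b ε₀ ε₁) (hu : t .u ≠ 0)
    (hV : t .V = 0) : slope ε₀ ε₁ t = 0 := by
  simpa [strictF₁, hu, hV] using (system_eq_zero_iff.1 ht.2).2.2.2.2

theorem θ_eq_of_blowDown_eq (hb : 0 < b) (hab : b < a) (hε : ε₁ ^ 2 * (2 * a) < ε₀)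
    (hs : s ∈ blowUp a b ε₀ ε₁) (ht : t ∈ blowUp a b ε₀ ε₁) (hst : s ∈ angleStrip (t .θ))
    (h : blowDown ε₁ s = blowDown ε₁ t) : s .θ = t .θ := by
  have hx := exp_mul_x₂_blowDown ε₁ s
  rw [h] at hx
  have hw := exp_mul_w₂_blowDown ε₁ s
  rw [h] at hw
  by_cases hx₀ : x₂ (blowDown ε₁ t) = 0
  swap
  · exact eq_of_im_exp_mul_I_mul_eq_zero hx₀ hst (by rw [exp_mul_x₂_blowDown, ofReal_im])
      (by rw [hx, ofReal_im])
  have hρt : t .ρ = 0 := by simpa [hx₀] using (exp_mul_x₂_blowDown ε₁ t).symm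
  have hρs : s .ρ = 0 := by simpa [hx₀] using hx.symm
  obtain ⟨hut, -, hUt, -⟩ := eq_zero_of_mem_blowUp_of_ρ_eq_zero hb hab ht hρt
  obtain ⟨hus, -, hUs, -⟩ := eq_zero_of_mem_blowUp_of_ρ_eq_zero hb hab hs hρs
  by_cases hw₀ : w₂ (blowDown ε₁ t) - I * ε₁ * z₂ (blowDown ε₁ t) = 0
  swap
  · refine eq_of_im_exp_mul_I_mul_eq_zero (mul_ne_zero I_ne_zero hw₀) hst ?_ ?_
    · rw [mul_left_comm, exp_mul_w₂_blowDown, hUt]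
      simp
    · rw [mul_left_comm, hw, hUs]
      simp
  have hVt : t .V = 0 := by simpa [hw₀, hUt] using exp_mul_w₂_blowDown ε₁ t
  have hVs : s .V = 0 := by simpa [hw₀, hUs] using hw
  refine eq_of_im_exp_mul_I_mul_eq_zero (ε₀_add_sub_ne_zero hb hab hε ht) hst
    (by rw [im_exp_mul_eq_slope, slope_eq_zero_of_mem_blowUp ht hut hVt]) ?_
  have hk : s .k = t .k := by
    rw [← blowUpCoord_blowDown ε₁ s, ← blowUpCoord_blowDown ε₁ t, h]
    rfl
  have hy : yCoord s = yCoord t := by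
    have hy₁ (r : Coord → ℝ) : y₁ (blowDown ε₁ r) = yCoord r := y₁_ofComplex ..
    rw [← hy₁, ← hy₁, h]
  rw [← hk, ← hy, im_exp_mul_eq_slope, slope_eq_zero_of_mem_blowUp hs hus hVs]

theorem eq_of_blowDown_eq (hb : 0 < b) (hab : b < a) (hε : ε₁ ^ 2 * (2 * a) < ε₀)
    (hs : s ∈ blowUp a b ε₀ ε₁) (ht : t ∈ blowUp a b ε₀ ε₁) (hst : s ∈ angleStrip (t .θ))
    (h : blowDown ε₁ s = blowDown ε₁ t) : s = t := by
  rw [← blowUpCoord_blowDown ε₁ s, h, θ_eq_of_blowDown_eq hb hab hε hs ht hst h,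
    blowUpCoord_blowDown]

end Uniqueness

section Immersion

variable {a b ε₀ ε₁ : ℝ} {t d : Coord → ℝ}

theorem hasLineDerivAt_comp_of_fderiv_eq_zero {𝕜 X Y Z : Type*} [NontriviallyNormedField 𝕜]
    [NormedAddCommGroup X] [NormedSpace 𝕜 X] [NormedAddCommGroup Y] [NormedSpace 𝕜 Y]
    [NormedAddCommGroup Z] [NormedSpace 𝕜 Z] {g : Y → Z} {f : X → Y} {p v : X}
    (hg : DifferentiableAt 𝕜 g (f p)) (hf : DifferentiableAt 𝕜 f p) (hv : fderiv 𝕜 f p v = 0) :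
    HasLineDerivAt 𝕜 (g ∘ f) 0 p v := by
  simpa [hv] using (hg.hasFDerivAt.comp p hf.hasFDerivAt).hasLineDerivAt v

theorem differentiable_blowDown (ε₁ : ℝ) : Differentiable ℝ (blowDown ε₁) :=
  (contDiff_blowDown ε₁).differentiable (by simp)

theorem eq_mul_of_fderiv_blowDown_eq_zero {ζ : V9 → ℂ} {c : (Coord → ℝ) → ℂ} {c' : ℂ}
    (hζ : Differentiable ℝ ζ) (hc : ∀ s, exp (s .θ * I) * ζ (blowDown ε₁ s) = c s)
    (hd : fderiv ℝ (blowDown ε₁) t d = 0) (hc' : HasLineDerivAt ℝ c c' t d) :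
    c' = d .θ * I * c t := by
  have hexp : HasLineDerivAt ℝ (fun s : Coord → ℝ => exp (s .θ * I))
      (exp (t .θ * I) * (d .θ * I)) t d :=
    (((hasDerivAt_add_smul_apply t d .θ).ofReal_comp).mul_const I).cexp.congr_deriv
      (by rw [zero_smul, add_zero])
  have hmul := HasDerivAt.mul hexp (hasLineDerivAt_comp_of_fderiv_eq_zero (hζ _)
    (differentiable_blowDown ε₁ t) hd)
  simp only [zero_smul, add_zero, mul_zero, Function.comp_apply] at hmul
  have hprod : HasLineDerivAt ℝ c (exp (t .θ * I) * (d .θ * I) * ζ (blowDown ε₁ t)) t d :=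
    hmul.congr_of_eventuallyEq (.of_forall fun s => (hc _).symm)
  rw [hc'.unique hprod, ← hc t]
  ring

theorem hasLineDerivAt_coord_add_mul_I (i j : Coord) (t d : Coord → ℝ) :
    HasLineDerivAt ℝ (fun s : Coord → ℝ => (s i + s j * I : ℂ)) (d i + d j * I) t d :=
  (hasDerivAt_add_smul_apply t d i).ofReal_comp.add
    ((hasDerivAt_add_smul_apply t d j).ofReal_comp.mul_const I)

theorem differentiable_x₂ : Differentiable ℝ x₂ := by
  have := ofRealCLM.differentiable
  unfold x₂ al be
  fun_prop

theorem differentiable_y₁ : Differentiable ℝ y₁ := by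
  have := ofRealCLM.differentiable
  unfold y₁ al be
  fun_prop

theorem differentiable_z₁ : Differentiable ℝ z₁ := by
  have := ofRealCLM.differentiable
  unfold z₁ al be
  fun_prop

theorem differentiable_w₂_sub (ε₁ : ℝ) : Differentiable ℝ fun q => w₂ q - I * ε₁ * z₂ q := by
  have := ofRealCLM.differentiable
  unfold w₂ z₂ mom al be
  fun_prop

theorem fderiv_blowDown_eq_zero (hd : fderiv ℝ (blowDown ε₁) t d = 0) :
    d .ρ = 0 ∧ d .θ * t .ρ = 0 ∧ d .g = -(d .θ * t .h) ∧ d .h = d .θ * t .g ∧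
      d .U = d .θ * t .V ∧ d .V = -(d .θ * t .U) ∧ d .u = 0 ∧ d .v = 0 ∧ d .k = 0 := by
  have hf := differentiable_blowDown ε₁ t
  have hy (s : Coord → ℝ) : y₁ (blowDown ε₁ s) = yCoord s := y₁_ofComplex ..
  have hx := eq_mul_of_fderiv_blowDown_eq_zero differentiable_x₂ (exp_mul_x₂_blowDown ε₁) hd
    (hasDerivAt_add_smul_apply t d .ρ).ofReal_comp
  have hgh := eq_mul_of_fderiv_blowDown_eq_zero differentiable_y₁
    (fun s => by rw [hy, exp_mul_yCoord]) hd (hasLineDerivAt_coord_add_mul_I .g .h t d)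
  have hUV := eq_mul_of_fderiv_blowDown_eq_zero (differentiable_w₂_sub ε₁)
    (exp_mul_w₂_blowDown ε₁) hd ((hasDerivAt_add_smul_apply t d .U).ofReal_comp.sub
      ((hasDerivAt_add_smul_apply t d .V).ofReal_comp.mul_const I))
  have huv : (d .u + d .v * I : ℂ) = 0 :=
    (hasLineDerivAt_coord_add_mul_I .u .v t d).unique <|
      (hasLineDerivAt_comp_of_fderiv_eq_zero (differentiable_z₁ _) hf hd).congr_of_eventuallyEq
        (.of_forall fun s => (z₁_ofComplex ..).symm)
  have hk : d .k = 0 := by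
    have him := imCLM.differentiable.comp differentiable_y₁
    have hζ : Differentiable ℝ fun q => mom q 2 / 2 + ε₁ * (y₁ q).im := by
      unfold mom
      exact .add (by fun_prop) (him.const_mul ε₁)
    have hderiv : HasLineDerivAt ℝ (fun s : Coord → ℝ => s .k) (d .k) t d :=
      hasDerivAt_add_smul_apply t d .k
    exact hderiv.unique <|
      (hasLineDerivAt_comp_of_fderiv_eq_zero (hζ _) hf hd).congr_of_eventuallyEq
        (.of_forall fun s => (congrFun (blowUpCoord_blowDown ε₁ s) .k).symm)
  obtain ⟨hdρ, hdθ⟩ : d .ρ = 0 ∧ d .θ * t .ρ = 0 := by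
    simpa [Complex.ext_iff] using hx
  obtain ⟨hdg, hdh⟩ : d .g = -(d .θ * t .h) ∧ d .h = d .θ * t .g := by
    simpa [Complex.ext_iff] using hgh
  obtain ⟨hdU, hdV⟩ : d .U = d .θ * t .V ∧ -d .V = d .θ * t .U := by
    simpa [Complex.ext_iff] using hUV
  obtain ⟨hdu, hdv⟩ : d .u = 0 ∧ d .v = 0 := by simpa [Complex.ext_iff] using huv
  exact ⟨hdρ, hdθ, hdg, hdh, hdU, neg_eq_iff_eq_neg.1 hdV, hdu, hdv, hk⟩

theorem eq_zero_of_fderiv_blowDown_eq_zero (hθ : d .θ = 0)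
    (hd : fderiv ℝ (blowDown ε₁) t d = 0) : d = 0 := by
  obtain ⟨hdρ, -, hdg, hdh, hdU, hdV, hdu, hdv, hdk⟩ := fderiv_blowDown_eq_zero hd
  rw [hθ, zero_mul] at hdh hdU
  rw [hθ, zero_mul, neg_zero] at hdg hdV
  exact funext (Coord.forall.2 ⟨hθ, hdρ, hdu, hdv, hdg, hdh, hdU, hdV, hdk⟩)

theorem eq_zero_of_fderiv_blowDown_eq_zero_of_ρ_ne_zero (hρ : t .ρ ≠ 0)
    (hd : fderiv ℝ (blowDown ε₁) t d = 0) : d = 0 :=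
  eq_zero_of_fderiv_blowDown_eq_zero
    ((mul_eq_zero.1 (fderiv_blowDown_eq_zero hd).2.1).resolve_right hρ) hd

theorem eq_zero_of_fderiv_blowDown_eq_zero_of_fderiv_system_eq_zero (hb : 0 < b) (hab : b < a)
    (hε : ε₁ ^ 2 * (2 * a) < ε₀) (ht : t ∈ blowUp a b ε₀ ε₁) (hρ : t .ρ = 0)
    (hsys : fderiv ℝ (system a b (strictF₁ ε₀ ε₁)) t d = 0)
    (hd : fderiv ℝ (blowDown ε₁) t d = 0) : d = 0 := by
  obtain ⟨hu, hv, hU, -⟩ := eq_zero_of_mem_blowUp_of_ρ_eq_zero hb hab ht hρ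
  obtain ⟨hdρ, -, -, hdh, hdU, hdV, hdu, hdv, hdk⟩ := fderiv_blowDown_eq_zero hd
  refine eq_zero_of_fderiv_blowDown_eq_zero (by_contra fun hθ => ?_) hd
  rw [fderiv_system ((contDiff_strictF₁ ε₀ ε₁).differentiable one_ne_zero)] at hsys
  have hV : t .V = 0 := by
    simpa [hdU, hdV, hdu, hdv, hdk, hdρ, hρ, hv, hU, hu, hθ] using congrFun hsys 3
  have hrate : ε₀ * cos (t .θ) - 2 * ε₁ * t .k * sin (t .θ) - ε₁ ^ 2 * t .g = 0 := by
    have hstrict : fderiv ℝ (strictF₁ ε₀ ε₁) t d = 0 := congrFun hsys 4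
    rw [fderiv_strictF₁, fderiv_slope, hdh, hdV, hdu, hdk, hV, hU] at hstrict
    exact mul_left_cancel₀ (mul_ne_zero (pow_ne_zero 2 hu) hθ)
      (by linear_combination -hstrict)
  have hslope := slope_eq_zero_of_mem_blowUp ht hu hV
  have hcs := Real.sin_sq_add_cos_sq (t .θ)
  refine (slope_rate_pos hb hab hε ht (p := t .g * cos (t .θ) + t .h * sin (t .θ)) ?_).ne' ?_
  · calc
      (t .g * cos (t .θ) + t .h * sin (t .θ)) ^ 2
        ≤ (t .g ^ 2 + t .h ^ 2) * (sin (t .θ) ^ 2 + cos (t .θ) ^ 2) := by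
          linear_combination sq_nonneg (t .g * sin (t .θ) - t .h * cos (t .θ))
      _ = t .g ^ 2 + t .h ^ 2 := by rw [hcs, mul_one]
  · rw [slope] at hslope
    linear_combination cos (t .θ) * hrate + sin (t .θ) * hslope - ε₀ * hcs

end Immersion

section Chart

variable {a b ε₀ ε₁ : ℝ} {t : Coord → ℝ}

theorem card_Coord : Fintype.card Coord = 9 := rfl

theorem map_blowDown_nhdsWithin_blowUp (hb : 0 < b) (hab : b < a) (hε : ε₁ ^ 2 * (2 * a) < ε₀)
    (ht : t ∈ blowUp a b ε₀ ε₁) :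
    map (blowDown ε₁) (𝓝[blowUp a b ε₀ ε₁] t) = 𝓝[M2 a b ε₀ ε₁] (blowDown ε₁ t) := by
  have himage := M2_eq_image hb hab hε
  rw [himage]
  exact map_nhdsWithin_eq_of_isClosedMap (contDiff_blowDown ε₁).continuous
    (isClosed_blowUp a b ε₀ ε₁) (isClosedMap_domRestrict_blowDown ε₁ (t .θ))
    ((M2_eq_image_inter_angleStrip hb hab hε (t .θ)).symm.trans himage)
    fun s hs => eq_of_blowDown_eq hb hab hε hs.1 ht hs.2

theorem hasSmoothChartAt_M2_of_system (hb : 0 < b) (hab : b < a) (hε : ε₁ ^ 2 * (2 * a) < ε₀)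
    (ht : t ∈ blowUp a b ε₀ ε₁) {f : (Coord → ℝ) → ℝ} (hf : ContDiff ℝ ∞ f)
    (hsurj : Function.Surjective (fderiv ℝ (system a b f) t))
    (hinj : ∀ d, fderiv ℝ (system a b f) t d = 0 → fderiv ℝ (blowDown ε₁) t d = 0 → d = 0)
    (hsys : ∀ᶠ s in 𝓝 t, s ∈ blowUp a b ε₀ ε₁ ↔ system a b f s = 0) :
    HasSmoothChartAt 4 (M2 a b ε₀ ε₁) (blowDown ε₁ t) := by
  refine .of_levelSet (contDiff_system hf) (contDiff_blowDown ε₁) hsurj hinj ?_ ?_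
  · rw [finrank_fintype_fun_eq_card, finrank_fin_fun, card_Coord]
  · rw [← map_blowDown_nhdsWithin_blowUp hb hab hε ht]
    exact congrArg _ (nhdsWithin_eq_iff_eventuallyEq.2 (hsys.mono fun s hs => propext hs.symm))

theorem hasSmoothChartAt_M2 (hb : 0 < b) (hab : b < a) (hε : ε₁ ^ 2 * (2 * a) < ε₀)
    (ht : t ∈ blowUp a b ε₀ ε₁) : HasSmoothChartAt 4 (M2 a b ε₀ ε₁) (blowDown ε₁ t) := by
  by_cases hρ : t .ρ = 0
  · have hu := (eq_zero_of_mem_blowUp_of_ρ_eq_zero hb hab ht hρ).1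
    have hsurj := top_le_iff.1
      ((map_fderiv_system_strictF₁_eq_top hb hab hε ht hρ).ge.trans LinearMap.map_le_range)
    exact hasSmoothChartAt_M2_of_system hb hab hε ht (contDiff_strictF₁ ε₀ ε₁)
      (LinearMap.range_eq_top.1 hsurj)
      (fun d => eq_zero_of_fderiv_blowDown_eq_zero_of_fderiv_system_eq_zero hb hab hε ht hρ)
      (((continuous_apply Coord.u).continuousAt.eventually_ne hu).mono
        fun s hs => mem_blowUp_iff_of_u_ne_zero hs)
  · exact hasSmoothChartAt_M2_of_system hb hab hε ht (contDiff_totalF₁ ε₀ ε₁)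
      (surjective_fderiv_system_totalF₁ hb hab hε ht hρ)
      (fun d _ => eq_zero_of_fderiv_blowDown_eq_zero_of_ρ_ne_zero hρ)
      (((continuous_apply Coord.ρ).continuousAt.eventually_ne hρ).mono
        fun s hs => mem_blowUp_iff_of_ρ_ne_zero hs)

theorem isSmoothSubmanifold_M2 (hb : 0 < b) (hab : b < a) (hε : ε₁ ^ 2 * (2 * a) < ε₀) :
    IsSmoothSubmanifold 4 (M2 a b ε₀ ε₁) := by
  intro q hq
  rw [M2_eq_image hb hab hε] at hq
  obtain ⟨t, ht, rfl⟩ := hq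
  exact hasSmoothChartAt_M2 hb hab hε ht

theorem M2_nonempty (hb : 0 < b) (hab : b < a) (hε : ε₁ ^ 2 * (2 * a) < ε₀) :
    (M2 a b ε₀ ε₁).Nonempty := by
  let t : Coord → ℝ
    | .ρ => a + b
    | .g => a - b
    | _ => 0
  have hρ : t .ρ ≠ 0 := by
    change a + b ≠ 0
    linarith
  rw [M2_eq_image hb hab hε]
  refine ⟨_, t, (mem_blowUp_iff_of_ρ_ne_zero hρ).2 (system_eq_zero_iff.2 ⟨?_, ?_, ?_, ?_, ?_⟩), rfl⟩
    <;> simp only [t, totalF₁, slope, Real.sin_zero] <;> ring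

end Chart

end

end GTFG

theorem proposition3 (a b ε₀ : ℝ) (hb : 0 < b) (hab : b < a) (hε₀ : 0 < ε₀) :
    ∃ δ : ℝ, 0 < δ ∧ ∀ ε₁ : ℝ, |ε₁| < δ →
      (GTFG.M2 a b ε₀ ε₁).Nonempty ∧ GTFG.IsSmoothSubmanifold 4 (GTFG.M2 a b ε₀ ε₁) := by
  have ha : 0 < a := hb.trans hab
  refine ⟨Real.sqrt (ε₀ / (2 * a)), Real.sqrt_pos.2 (by positivity), fun ε₁ hε₁ => ?_⟩
  have hε : ε₁ ^ 2 * (2 * a) < ε₀ := by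
    rwa [Real.lt_sqrt (abs_nonneg ε₁), sq_abs, lt_div_iff₀ (by positivity)] at hε₁
  exact ⟨GTFG.M2_nonempty hb hab hε, GTFG.isSmoothSubmanifold_M2 hb hab hε⟩
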